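/- Let $\mathcal{X}=\{1,2,\dots\}$, let $Q$ be a probability distribution on $\mathcal{X}$ with decreasing rearrangement $Q^{\downarrow}(1)\ge Q^{\downarrow}(2)\ge\cdots$, let $\mathcal{Y}$ be a measurable space, $L\ge 1$ an integer and $\varepsilon$ a real number. For a pair $(X,Y)$ of $\mathcal{X}$- and $\mathcal{Y}$-valued random variables let $$P_{\mathrm e}^{(L)}(X\mid Y)=\min_{f}\mathbb{P}\{X\notin f(Y)\},$$ where $f$ runs over the measurable maps from $\mathcal{Y}$ to the nonempty subsets of $\mathcal{X}$ with at most $L$ elements. Suppose that $$1-\sum_{x=1}^{\#(\mathcal{Y})L}Q^{\downarrow}(x)\ \le\ \varepsilon\ \le\ 1-\sum_{x=1}^{L}Q^{\downarrow}(x),$$ where $\#(\mathcal{Y})$ is the number of elements of $\mathcal{Y}$ ($\infty$ if $\mathcal{Y}$ is infinite). Put $$\mathcal{V}(j)=\frac{(1-\varepsilon)-\sum_{x=1}^{j-1}Q^{\downarrow}(x)}{L-j+1}\ \ (1\le j\le L),\qquad \mathcal{V}(j)=1\ \ (j>L),$$ $$\mathcal{W}(L)=-1,\qquad \mathcal{W}(k)=\frac{\sum_{x=1}^{k}Q^{\downarrow}(x)-(1-\varepsilon)}{k-L}\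 \ (L<k<\infty),\qquad \mathcal{W}(\infty)=0,$$ $J=\min\{1\le j<\infty: Q^{\downarrow}(j)<\mathcal{V}(j)\}$ and $K_1=\sup\{L\le k<\infty:\mathcal{W}(k)<Q^{\downarrow}(k)\}\in\{L,L+1,\dots,\infty\}$. The type-1 Fano distribution $P_1$ is defined by $P_1(x)=Q^{\downarrow}(x)$ if $x<J$ or $x>K_1$, $P_1(x)=\mathcal{V}(J)$ if $J\le x\le L$, and $P_1(x)=\mathcal{W}(K_1)$ if $L<x\le K_1$. It is a probability distribution on $\mathcal{X}$. For $\alpha\in(0,1)\cup(1,\infty)$ let $\|P\|_\alpha=\big(\sum_x P(x)^\alpha\big)^{1/\alpha}$, and let $$H_\alpha(P)=\tfrac{1}{1-\alpha}\log\sum_x P(x)^\alpha,\quad H_\alpha^{\mathrm A}(X\mid Y)=\tfrac{\alpha}{1-\alpha}\log\mathbb{E}\big[\|P_{X|Y}\|_\alpha\big],\quad H_\alpha^{\mathrm H}(X\mid Y)=\tfrac{1}{1-\alpha}\log\mathbb{E}\big[\|P_{X|Y}\|_\alpha^\alpha\big]$$ be the Rényi entropy and Arimoto's and Hayashi's conditional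 Rényi entropies, where $P_{X|Y}$ is the regular conditional distribution of $X$ given $Y$. Let $\eta(u)=-u\log u$ with $\eta(0)=0$, let $H_1(P)=H(P)=\sum_x\eta(P(x))$ and $H_1^{\mathrm A}(X\mid Y)=H_1^{\mathrm H}(X\mid Y)=H(X\mid Y)=\mathbb{E}[H(P_{X|Y})]$. All these quantities may be $+\infty$. Then for each $\dagger\in\{\mathrm A,\mathrm H\}$ and each $\alpha\in(0,\infty)$, $$\sup_{(X,Y):\ P_{\mathrm e}^{(L)}(X\mid Y)\le\varepsilon,\ P_X=Q}H_\alpha^{\dagger}(X\mid Y)\ \le\ H_\alpha(P_1),$$ and, with the convention $\infty\cdot 0=0$ (and the term with the factor $K_1-L$ read as $0$ if $K_1=L$), $$H_\alpha(P_1)=\frac{1}{1-\alpha}\log\Big((L-J+1)\,\mathcal{V}(J)^\alpha+(K_1-L)\,\mathcal{W}(K_1)^\alpha+\sum_{x<J\text{ or }x>K_1}Q^{\downarrow}(x)^\alpha\Big)\quad(\alpha\ne1),$$ $$H_1(P_1)=(L-J+1)\,\eta(\mathcal{V}(J))+(K_1-L)\,\eta(\mathcal{W}(K_1))+\sum_{x<J\text{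 or }x>K_1}\eta(Q^{\downarrow}(x)).$$ In particular, for $\alpha=1$ and $L=1$ this yields the Ho–Verdú–Fano inequality: all $\mathcal{X}$-valued random variables $X,Y$ with $\mathbb{P}\{X\ne Y\}\le\varepsilon$ and $P_X=Q$ satisfy $$H(X\mid Y)\ \le\ \eta(1-\varepsilon)+(K_1-1)\,\eta(\mathcal{W}(K_1))+\sum_{x>K_1}\eta(Q^{\downarrow}(x)),$$ with the same conventions. -/

import Mathlib

open MeasureTheory ProbabilityTheory
open scoped ENNReal

noncomputable section

namespace FanoRenyi

/-- The alphabet `{1, 2, …}` carries the discrete σ-algebra. -/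
instance : MeasurableSpace ℕ+ := ⊤

instance : DiscreteMeasurableSpace ℕ+ := ⟨fun _ => trivial⟩

/-- `decr Q n` is the `n`-th largest mass (counted with multiplicity, `n ≥ 1`) of the probability
distribution `Q` on `{1, 2, …}`: the least `t ≥ 0` such that fewer than `n` of the masses exceed
`t`. So `decr Q 1 ≥ decr Q 2 ≥ ⋯` is the decreasing rearrangement of `Q`. The index `0` is not
used. -/
def decr (Q : PMF ℕ+) (n : ℕ) : ℝ :=
  sInf {t : ℝ | 0 ≤ t ∧ {x : ℕ+ | t < (Q x).toReal}.encard < (n : ℕ∞)}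

/-- The weight `V(j)`, for `j ≥ 1`. -/
def weightV (Q : PMF ℕ+) (L : ℕ) (ε : ℝ) (j : ℕ) : ℝ :=
  if j ≤ L then ((1 - ε) - ∑ x ∈ Finset.Ico 1 j, decr Q x) / ((L : ℝ) - (j : ℝ) + 1) else 1

/-- The weight `W(k)`, for `L ≤ k ≤ ∞`. -/
def weightW (Q : PMF ℕ+) (L : ℕ) (ε : ℝ) (k : ℕ∞) : ℝ :=
  if k = ⊤ then 0
  else if k = (L : ℕ∞) then -1
  else (∑ x ∈ Finset.Icc 1 k.toNat, decr Q x - (1 - ε)) / ((k.toNat : ℝ) - (L : ℝ))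

/-- The integer `J = min {1 ≤ j < ∞ | Q↓(j) < V(j)}`. -/
def indexJ (Q : PMF ℕ+) (L : ℕ) (ε : ℝ) : ℕ :=
  sInf {j : ℕ | 1 ≤ j ∧ decr Q j < weightV Q L ε j}

/-- `K = sup {L ≤ k < ∞ | W(k) < Q↓(k)}`, possibly `∞`. -/
def indexK (Q : PMF ℕ+) (L : ℕ) (ε : ℝ) : ℕ∞ :=
  sSup {m : ℕ∞ | ∃ k : ℕ, m = (k : ℕ∞) ∧ L ≤ k ∧ weightW Q L ε (k : ℕ∞) < decr Q k}

/-- The Fano-distribution of type 1. -/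
def fanoType1 (Q : PMF ℕ+) (L : ℕ) (ε : ℝ) (x : ℕ+) : ℝ :=
  if (x : ℕ) < indexJ Q L ε ∨ indexK Q L ε < ((x : ℕ) : ℕ∞) then decr Q (x : ℕ)
  else if (x : ℕ) ≤ L then weightV Q L ε (indexJ Q L ε)
  else weightW Q L ε (indexK Q L ε)

/-- The Shannon entropy `∑ₓ P(x) log (1 / P(x)) ∈ [0, ∞]` (`0 log (1/0) = 0`, natural logarithm);
`Real.negMulLog u = -u log u`. -/
def shannon (P : ℕ+ → ℝ) : ℝ≥0∞ := ∑' x, ENNReal.ofReal (Real.negMulLog (P x))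

/-- `∑ₓ P(x)^α ∈ [0, ∞]`. -/
def powerSum (α : ℝ) (P : ℕ+ → ℝ) : ℝ≥0∞ := ∑' x, ENNReal.ofReal (P x) ^ α

/-- The `ℓ_α`-norm `(∑ₓ P(x)^α)^(1/α) ∈ [0, ∞]`. -/
def alphaNorm (α : ℝ) (P : ℕ+ → ℝ) : ℝ≥0∞ := powerSum α P ^ (1 / α)

/-- The Rényi entropy of order `α`, equal to the Shannon entropy if `α = 1`. -/
def renyi (α : ℝ) (P : ℕ+ → ℝ) : EReal :=
  if α = 1 then ((shannon P : ℝ≥0∞) : EReal)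
  else ((1 / (1 - α) : ℝ) : EReal) * ENNReal.log (powerSum α P)

section Conditional

variable {Ω 𝒴 : Type*} [MeasurableSpace Ω] [MeasurableSpace 𝒴]

/-- The random distribution `P_{X|Y}` (regular conditional distribution of `X` given `Y`). -/
def condLaw (μ : Measure Ω) [IsFiniteMeasure μ] (X : Ω → ℕ+) (Y : Ω → 𝒴) (ω : Ω) (x : ℕ+) : ℝ :=
  (condDistrib X Y μ (Y ω)).real {x}

/-- The conditional Shannon entropy `H(X | Y) = 𝔼[H(P_{X|Y})]`. -/
def condShannon (μ : Measure Ω) [IsFiniteMeasure μ] (X : Ω → ℕ+) (Y : Ω → 𝒴) : ℝ≥0∞ :=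
  ∫⁻ ω, shannon (condLaw μ X Y ω) ∂μ

/-- The two kinds of conditional Rényi entropy. -/
inductive Kind
  | arimoto
  | hayashi

/-- Arimoto's and Hayashi's conditional Rényi entropies of order `α`; both are the conditional
Shannon entropy if `α = 1`. -/
def condRenyi (kind : Kind) (α : ℝ) (μ : Measure Ω) [IsFiniteMeasure μ]
    (X : Ω → ℕ+) (Y : Ω → 𝒴) : EReal :=
  if α = 1 then ((condShannon μ X Y : ℝ≥0∞) : EReal)
  else match kind with
    | Kind.arimoto =>
        ((α / (1 - α) : ℝ) : EReal) * ENNReal.log (∫⁻ ω, alphaNorm α (condLaw μ X Y ω) ∂μ)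
    | Kind.hayashi =>
        ((1 / (1 - α) : ℝ) : EReal) * ENNReal.log (∫⁻ ω, alphaNorm α (condLaw μ X Y ω) ^ α ∂μ)

/-- A (measurable) list decoder with list size `L`: it maps each `y` to a nonempty set of at most
`L` letters. -/
def IsListDecoder (L : ℕ) (f : 𝒴 → Finset ℕ+) : Prop :=
  (∀ y, 1 ≤ (f y).card ∧ (f y).card ≤ L) ∧ ∀ x, MeasurableSet {y | x ∈ f y}

/-- The minimum average error probability under list decoding with list size `L`. -/
def listError (L : ℕ) (μ : Measure Ω) (X : Ω → ℕ+) (Y : Ω → 𝒴) : ℝ :=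
  sInf {p : ℝ | ∃ f : 𝒴 → Finset ℕ+, IsListDecoder L f ∧ p = μ.real {ω | X ω ∉ f (Y ω)}}

end Conditional

end FanoRenyi

end

/-!
Rearrange the conditional masses of `X` given `Y = y` in decreasing order and average over `y`. The
result is a decreasing sequence whose partial sums dominate those of the rearranged `Q` and which,
since the best list decoder picks the `L` largest conditional masses, puts at least `1 - ε` on its
first `L` terms. The Fano distribution is the least such sequence for submajorization: it raises the
first `L` masses of `Q` just enough to reach `1 - ε`, and pays for this by cutting down the largest
of the other ones.

Write `p` for a conditional mass sequence and `r` for the Fano distribution. The `α`-norm of `p` is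
at most (at least if `α > 1`) its tangent at `r`, by Hölder's inequality; this is a multiple of the
linear functional with coefficients `r n ^ (α - 1)`. If `α = 1`, Gibbs' inequality bounds the
entropy in the same way with the coefficients `-log (r n)`. The coefficients are monotone in `n`, so
by Abel summation the average over `y` of the linear functional is at most (at least if `α > 1`) its
value at `r`, where the tangent touches. Thus a single linear functional replaces both
Schur-concavity and Jensen's inequality. Hayashi's entropy lies below Arimoto's by the monotonicity
of power means.
-/

noncomputable section

namespace FanoRenyi

theorem encard_setOf_natCast_succ_le (N : ℕ∞) : {i : ℕ | ((i + 1 : ℕ) : ℕ∞) ≤ N}.encard = N := by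
  induction N using ENat.recTopCoe with
  | top => simp [Set.encard_univ]
  | coe N =>
    have : {i : ℕ | ((i + 1 : ℕ) : ℕ∞) ≤ (N : ℕ∞)} = (Finset.range N : Set ℕ) := by
      ext i
      rw [Set.mem_ofPred_eq, Nat.cast_le, Finset.mem_coe, Finset.mem_range, Nat.succ_le_iff]
    rw [this, Set.encard_coe_eq_coe_finsetCard, Finset.card_range]

section Rearrangement

open Filter Topology

variable (Q : PMF ℕ+)

/-- The decreasing rearrangement of `Q`, indexed from `0` so that the sum of the `k` largest masses
runs over `Finset.range k`. -/
def sortedMass (i : ℕ) : ℝ := decr Q (i + 1)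

theorem sortedMass_natPred (x : ℕ+) : sortedMass Q x.natPred = decr Q x := by
  rw [sortedMass, PNat.natPred_add_one]

theorem sortedMass_nonneg (i : ℕ) : 0 ≤ sortedMass Q i := Real.sInf_nonneg fun _ h => h.1

theorem summable_toReal_mass : Summable fun x => (Q x).toReal :=
  ENNReal.summable_toReal Q.tsum_coe_ne_top

theorem finite_setOf_lt_mass {t : ℝ} (ht : 0 < t) : {x : ℕ+ | t < (Q x).toReal}.Finite := by
  have h := (summable_toReal_mass Q).tendsto_cofinite_zero.eventually (gt_mem_nhds ht)
  exact (Filter.eventually_cofinite.1 h).subset fun x hx => not_lt.2 (le_of_lt hx)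

theorem exists_encard_lt_succ (i : ℕ) :
    ∃ t : ℝ, 0 ≤ t ∧ {x : ℕ+ | t < (Q x).toReal}.encard < ((i + 1 : ℕ) : ℕ∞) := by
  have : {x : ℕ+ | (1 : ℝ) < (Q x).toReal} = ∅ :=
    Set.eq_empty_of_forall_notMem fun x hx =>
      not_le.2 hx (ENNReal.toReal_le_of_le_ofReal zero_le_one (by simpa using Q.coe_le_one x))
  exact ⟨1, zero_le_one, by simp [this]⟩

theorem antitone_sortedMass : Antitone (sortedMass Q) := fun i j hij =>
  csInf_le_csInf ⟨0, fun _ h => h.1⟩ (exists_encard_lt_succ Q i) fun _ h =>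
    ⟨h.1, h.2.trans_le (by exact_mod_cast Nat.succ_le_succ hij)⟩

theorem le_sortedMass_of_succ_le_encard {v : ℝ} {i : ℕ}
    (h : ((i + 1 : ℕ) : ℕ∞) ≤ {x : ℕ+ | v ≤ (Q x).toReal}.encard) : v ≤ sortedMass Q i := by
  refine le_csInf (exists_encard_lt_succ Q i) fun u hu => ?_
  by_contra! huv
  have : {x : ℕ+ | v ≤ (Q x).toReal} ⊆ {x : ℕ+ | u < (Q x).toReal} := fun x => huv.trans_le
  exact (h.trans (Set.encard_le_encard this)).not_gt hu.2

theorem lt_sortedMass_iff {t : ℝ} (ht : 0 ≤ t) {i : ℕ} :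
    t < sortedMass Q i ↔ ((i + 1 : ℕ) : ℕ∞) ≤ {x : ℕ+ | t < (Q x).toReal}.encard := by
  constructor
  · intro h
    by_contra! hc
    exact (csInf_le ⟨0, fun _ h => h.1⟩ ⟨ht, hc⟩ : sortedMass Q i ≤ t).not_gt h
  · intro h
    obtain ⟨S, hSt, hcard⟩ := Set.exists_subset_encard_eq h
    have hne : S.Nonempty := by simp [← Set.encard_ne_zero, hcard]
    obtain ⟨x, hx, hmin⟩ := Set.exists_min_image S (fun x => (Q x).toReal)
      (Set.finite_of_encard_eq_coe hcard) hne
    exact (hSt hx).trans_le (le_sortedMass_of_succ_le_encard Q (hcard ▸ Set.encard_le_encard hmin))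

theorem exists_lt_setOf_lt_mass_eq {v : ℝ} (hv : 0 < v) :
    ∃ t, 0 < t ∧ t < v ∧ {x : ℕ+ | t < (Q x).toReal} = {x : ℕ+ | v ≤ (Q x).toReal} := by
  have hgap : ∀ᶠ t in 𝓝[<] v, ∀ x ∈ {x : ℕ+ | v / 2 < (Q x).toReal},
      t < (Q x).toReal → v ≤ (Q x).toReal := by
    refine (eventually_all_finite (finite_setOf_lt_mass Q (half_pos hv))).2 fun x _ => ?_
    rcases le_or_gt v (Q x).toReal with hx | hx
    · exact .of_forall fun _ _ => hx
    · filter_upwards [Ioo_mem_nhdsLT hx] with t ht h using absurd h ht.1.not_gt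
  obtain ⟨t, ht, htv⟩ := (hgap.and (Ioo_mem_nhdsLT (half_lt_self hv))).exists
  refine ⟨t, (half_pos hv).trans htv.1, htv.2, Set.Subset.antisymm (fun x hx => ?_) fun x hx => ?_⟩
  · exact ht x (htv.1.trans hx) hx
  · exact htv.2.trans_le hx

theorem le_sortedMass_iff {v : ℝ} (hv : 0 < v) {i : ℕ} :
    v ≤ sortedMass Q i ↔ ((i + 1 : ℕ) : ℕ∞) ≤ {x : ℕ+ | v ≤ (Q x).toReal}.encard := by
  refine ⟨fun h => ?_, le_sortedMass_of_succ_le_encard Q⟩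
  obtain ⟨t, ht, htv, hset⟩ := exists_lt_setOf_lt_mass_eq Q hv
  exact hset ▸ (lt_sortedMass_iff Q ht.le).1 (htv.trans_le h)

theorem encard_setOf_lt_sortedMass {t : ℝ} (ht : 0 ≤ t) :
    {i | t < sortedMass Q i}.encard = {x : ℕ+ | t < (Q x).toReal}.encard := by
  simp only [lt_sortedMass_iff Q ht, encard_setOf_natCast_succ_le]

theorem encard_setOf_le_sortedMass {v : ℝ} (hv : 0 < v) :
    {i | v ≤ sortedMass Q i}.encard = {x : ℕ+ | v ≤ (Q x).toReal}.encard := by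
  simp only [le_sortedMass_iff Q hv, encard_setOf_natCast_succ_le]

theorem encard_setOf_eq {ι : Type*} (f : ι → ℝ) {v : ℝ} (h : {i | v < f i}.Finite) :
    {i | f i = v}.encard = {i | v ≤ f i}.encard - {i | v < f i}.encard := by
  have h1 : {i | f i = v} = {i | v ≤ f i} \ {i | v < f i} := by
    ext i
    simp [le_antisymm_iff, and_comm]
  have h2 : {i | v < f i} ⊆ {i | v ≤ f i} := fun _ => le_of_lt (α := ℝ)
  rw [h1, Set.encard_sdiff h2 h]

theorem encard_setOf_sortedMass_eq {v : ℝ} (hv : 0 < v) :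
    {i | sortedMass Q i = v}.encard = {x : ℕ+ | (Q x).toReal = v}.encard := by
  have hfin := finite_setOf_lt_mass Q hv
  have hfin' : {i | v < sortedMass Q i}.Finite := by
    rwa [← Set.encard_lt_top_iff, encard_setOf_lt_sortedMass Q hv.le, Set.encard_lt_top_iff]
  rw [encard_setOf_eq _ hfin, encard_setOf_eq _ hfin', encard_setOf_lt_sortedMass Q hv.le,
    encard_setOf_le_sortedMass Q hv]

theorem exists_equiv_support_of_equiv_fiber {ι κ : Type*} {f : ι → ℝ} {g : κ → ℝ}
    (h : ∀ v ≠ 0, Nonempty ({i // f i = v} ≃ {j // g j = v})) :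
    ∃ e : Function.support f ≃ Function.support g, ∀ i, g (e i) = f i := by
  have hfiber (v : ℝ) : Nonempty ({a : Function.support f // f a = v} ≃
      {b : Function.support g // g b = v}) := by
    rcases eq_or_ne v 0 with rfl | hv
    · have : IsEmpty {a : Function.support f // f a = 0} := ⟨fun a => a.1.2 a.2⟩
      have : IsEmpty {b : Function.support g // g b = 0} := ⟨fun b => b.1.2 b.2⟩
      exact ⟨Equiv.equivOfIsEmpty _ _⟩
    · obtain ⟨e⟩ := h v hv
      exact ⟨(Equiv.subtypeSubtypeEquivSubtype fun hi => hi.trans_ne hv).trans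
        (e.trans (Equiv.subtypeSubtypeEquivSubtype fun hj => hj.trans_ne hv).symm)⟩
  exact ⟨Equiv.ofFiberEquiv (f := fun a : Function.support f => f a)
    (g := fun b : Function.support g => g b) fun v => (hfiber v).some,
    Equiv.ofFiberEquiv_map (f := fun a : Function.support f => f a)
      (g := fun b : Function.support g => g b) fun v => (hfiber v).some⟩

theorem nonempty_equiv_of_encard_eq {ι κ : Type*} {s : Set ι} {t : Set κ} (hs : s.Finite)
    (h : s.encard = t.encard) : Nonempty (s ≃ t) := by
  have := hs.to_subtype
  have := (Set.encard_lt_top_iff.1 (h ▸ hs.encard_lt_top) : t.Finite).to_subtype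
  refine Finite.card_eq.1 ?_
  rw [Nat.card_coe_set_eq, Nat.card_coe_set_eq, Set.ncard_def, Set.ncard_def, h]

theorem exists_equiv_support_sortedMass :
    ∃ e : (Function.support fun x => (Q x).toReal) ≃ Function.support (sortedMass Q),
      ∀ x, sortedMass Q (e x) = (Q x).toReal := by
  refine exists_equiv_support_of_equiv_fiber fun v hv => ?_
  rcases hv.lt_or_gt with hv | hv
  · have : IsEmpty {x : ℕ+ // (Q x).toReal = v} :=
      ⟨fun x => (ENNReal.toReal_nonneg.trans_eq x.2).not_gt hv⟩
    have : IsEmpty {i // sortedMass Q i = v} :=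
      ⟨fun i => ((sortedMass_nonneg Q i).trans_eq i.2).not_gt hv⟩
    exact ⟨Equiv.equivOfIsEmpty _ _⟩
  · have hfin : {x : ℕ+ | (Q x).toReal = v}.Finite :=
      (finite_setOf_lt_mass Q (half_pos hv)).subset fun x hx => (half_lt_self hv).trans_eq hx.symm
    exact nonempty_equiv_of_encard_eq hfin (encard_setOf_sortedMass_eq Q hv).symm

theorem tsum_comp_mass_eq_tsum_sortedMass {F : ℝ → ℝ≥0∞} (hF : F 0 = 0) :
    ∑' x, F (Q x).toReal = ∑' i, F (sortedMass Q i) := by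
  obtain ⟨e, he⟩ := exists_equiv_support_sortedMass Q
  have hsupp {ι : Type} (f : ι → ℝ) : ∑' a : Function.support f, F (f a) = ∑' a, F (f a) :=
    tsum_subtype_eq_of_support_subset (f := fun a => F (f a)) fun a (ha : F (f a) ≠ 0) hfa =>
      ha (by rw [hfa, hF])
  rw [← hsupp, ← hsupp (sortedMass Q), ← e.tsum_eq]
  simp only [he]

theorem hasSum_sortedMass : HasSum (sortedMass Q) 1 := by
  have h : ∑' i, ENNReal.ofReal (sortedMass Q i) = 1 := by
    rw [← tsum_comp_mass_eq_tsum_sortedMass Q ENNReal.ofReal_zero, ← Q.tsum_coe]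
    exact tsum_congr fun x => ENNReal.ofReal_toReal (Q.apply_ne_top x)
  have := ENNReal.hasSum_toReal (h.trans_ne ENNReal.one_ne_top)
  rw [← ENNReal.tsum_toReal_eq fun _ => ENNReal.ofReal_ne_top, h] at this
  simpa only [ENNReal.toReal_ofReal (sortedMass_nonneg Q _), ENNReal.toReal_one] using this

theorem exists_finset_sum_eq_of_equiv_support {ι κ : Type*} {f : ι → ℝ} {g : κ → ℝ}
    (e : Function.support f ≃ Function.support g) (he : ∀ i, g (e i) = f i) (S : Finset ι) :
    ∃ T : Finset κ, T.card ≤ S.card ∧ ∑ j ∈ T, g j = ∑ i ∈ S, f i := by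
  classical
  set S' : Finset (Function.support f) := S.subtype (· ∈ Function.support f) with hS'
  refine ⟨(S'.map e.toEmbedding).map (Function.Embedding.subtype _), ?_, ?_⟩
  · rw [Finset.card_map, Finset.card_map, hS', Finset.card_subtype]
    exact Finset.card_filter_le _ _
  · simp only [Finset.sum_map, Function.Embedding.subtype_apply, Equiv.coe_toEmbedding, he, hS']
    rw [Finset.sum_subtype_eq_sum_filter (f := f)]
    exact Finset.sum_filter_of_ne fun _ _ h => h

theorem sum_le_sum_range_of_antitone {f : ℕ → ℝ} (hf : Antitone f) (h0 : ∀ i, 0 ≤ f i)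
    {S : Finset ℕ} {k : ℕ} (hS : S.card ≤ k) : ∑ i ∈ S, f i ≤ ∑ i ∈ Finset.range k, f i := by
  have hcard : (S \ Finset.range k).card ≤ (Finset.range k \ S).card := by
    rw [Finset.card_sdiff, Finset.card_sdiff, Finset.inter_comm, Finset.card_range]
    exact Nat.sub_le_sub_right hS _
  have h : ∑ i ∈ S \ Finset.range k, f i ≤ ∑ i ∈ Finset.range k \ S, f i := calc
    _ ≤ (S \ Finset.range k).card • f k := Finset.sum_le_card_nsmul _ _ _ fun i hi =>
      hf (not_lt.1 fun h => (Finset.mem_sdiff.1 hi).2 (Finset.mem_range.2 h))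
    _ ≤ (Finset.range k \ S).card • f k := nsmul_le_nsmul_left (h0 k) hcard
    _ ≤ _ := Finset.card_nsmul_le_sum _ _ _ fun i hi =>
      hf (Finset.mem_range.1 (Finset.mem_sdiff.1 hi).1).le
  rw [← Finset.sum_inter_add_sum_sdiff S (Finset.range k),
    ← Finset.sum_inter_add_sum_sdiff (Finset.range k) S, Finset.inter_comm]
  gcongr

theorem sum_mass_le_sum_sortedMass {S : Finset ℕ+} {k : ℕ} (hS : S.card ≤ k) :
    ∑ x ∈ S, (Q x).toReal ≤ ∑ i ∈ Finset.range k, sortedMass Q i := by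
  obtain ⟨e, he⟩ := exists_equiv_support_sortedMass Q
  obtain ⟨T, hT, hsum⟩ := exists_finset_sum_eq_of_equiv_support e he S
  exact hsum ▸ sum_le_sum_range_of_antitone (antitone_sortedMass Q) (sortedMass_nonneg Q)
    (hT.trans hS)

theorem exists_sum_mass_eq_sum_sortedMass (k : ℕ) :
    ∃ S : Finset ℕ+, S.card ≤ k ∧
      ∑ x ∈ S, (Q x).toReal = ∑ i ∈ Finset.range k, sortedMass Q i := by
  obtain ⟨e, he⟩ := exists_equiv_support_sortedMass Q
  obtain ⟨S, hS, hsum⟩ := exists_finset_sum_eq_of_equiv_support e.symm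
    (fun i => by rw [← he, e.apply_symm_apply]) (Finset.range k)
  exact ⟨S, hS.trans_eq (Finset.card_range k), hsum⟩

end Rearrangement

section Submajorization

open Finset

/-- Weak majorization of sequences by partial sums: for decreasing `p` and `q` this says that the
`k` largest terms of `p` sum to at most as much as the `k` largest terms of `q`, for every `k`. -/
def Submajorized {M : Type*} [AddCommMonoid M] [LE M] (p q : ℕ → M) : Prop :=
  ∀ k, ∑ i ∈ range k, p i ≤ ∑ i ∈ range k, q i

theorem submajorized_ofReal {p q : ℕ → ℝ} (hp : ∀ i, 0 ≤ p i) (hq : ∀ i, 0 ≤ q i)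
    (h : Submajorized p q) :
    Submajorized (fun i => ENNReal.ofReal (p i)) fun i => ENNReal.ofReal (q i) := fun k => by
  rw [← ENNReal.ofReal_sum_of_nonneg fun i _ => hp i,
    ← ENNReal.ofReal_sum_of_nonneg fun i _ => hq i]
  exact ENNReal.ofReal_le_ofReal (h k)

theorem sum_range_succ_mul_eq_abel {g : ℕ → ℝ≥0∞} (hg : Antitone g) (u : ℕ → ℝ≥0∞) (N : ℕ) :
    ∑ n ∈ range (N + 1), u n * g n =
      ∑ k ∈ range N, (∑ n ∈ range (k + 1), u n) * (g k - g (k + 1)) +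
        (∑ n ∈ range (N + 1), u n) * g N := by
  induction N with
  | zero => simp
  | succ N ih =>
    rw [sum_range_succ, ih, sum_range_succ (fun k => _ * (g k - g (k + 1))),
      sum_range_succ u (N + 1), add_mul, ← add_assoc, add_assoc (∑ k ∈ range N, _) (_ * (_ - _)),
      ← mul_add, tsub_add_cancel_of_le (hg N.le_succ)]

theorem tsum_mul_le_tsum_mul_of_antitone {p q g : ℕ → ℝ≥0∞} (h : Submajorized p q)
    (hg : Antitone g) : ∑' n, p n * g n ≤ ∑' n, q n * g n := by
  refine ENNReal.tsum_le_of_sum_range_le fun N => ?_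
  refine le_trans ?_ (ENNReal.sum_le_tsum (range (N + 1)))
  refine (sum_le_sum_of_subset (range_subset_range.2 N.le_succ)).trans ?_
  rw [sum_range_succ_mul_eq_abel hg, sum_range_succ_mul_eq_abel hg]
  exact add_le_add (sum_le_sum fun k _ => mul_le_mul_left (h _) _) (mul_le_mul_left (h _) _)

theorem exists_eq_sum_range_succ_of_monotone {g : ℕ → ℝ≥0∞} (hg : Monotone g) :
    ∃ d : ℕ → ℝ≥0∞, ∀ n, g n = ∑ k ∈ range (n + 1), d k := by
  refine ⟨fun k => Nat.casesOn k (g 0) fun j => g (j + 1) - g j, fun n => ?_⟩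
  induction n with
  | zero => simp
  | succ n ih =>
    rw [sum_range_succ, ← ih]
    exact (add_tsub_cancel_of_le (hg n.le_succ)).symm

theorem tsum_mul_sum_range_succ (u d : ℕ → ℝ≥0∞) :
    ∑' n, u n * ∑ k ∈ range (n + 1), d k = ∑' k, d k * ∑' n, u (n + k) := calc
  _ = ∑' n, ∑ x ∈ antidiagonal n, d x.1 * u (x.2 + x.1) := tsum_congr fun n => by
    rw [Nat.sum_antidiagonal_eq_sum_range_succ fun k m => d k * u (m + k), mul_sum]
    refine sum_congr rfl fun k hk => ?_
    rw [Nat.sub_add_cancel (mem_range_succ_iff.1 hk), mul_comm]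
  _ = ∑' x : ℕ × ℕ, d x.1 * u (x.2 + x.1) := by
    rw [← (HasAntidiagonal.sigmaAntidiagonalEquivProd (A := ℕ)).tsum_eq, ENNReal.tsum_sigma']
    exact tsum_congr fun n => (Finset.tsum_subtype (antidiagonal n) _).symm
  _ = _ := by
    simp only [ENNReal.tsum_prod', ENNReal.tsum_mul_left]

theorem tsum_nat_add_le_of_submajorized {p q : ℕ → ℝ≥0∞} (h : Submajorized p q)
    (hsum : ∑' n, q n = ∑' n, p n) (hp : ∑' n, p n ≠ ⊤) (k : ℕ) :
    ∑' n, q (n + k) ≤ ∑' n, p (n + k) := by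
  have hfin : ∑ n ∈ range k, p n ≠ ⊤ := ne_top_of_le_ne_top hp (ENNReal.sum_le_tsum _)
  refine (ENNReal.add_le_add_iff_left hfin).1 ?_
  calc ∑ n ∈ range k, p n + ∑' n, q (n + k)
      ≤ ∑ n ∈ range k, q n + ∑' n, q (n + k) := add_le_add_left (h k) _
    _ = ∑ n ∈ range k, p n + ∑' n, p (n + k) := by
      rw [ENNReal.summable.sum_add_tsum_nat_add', hsum, ENNReal.summable.sum_add_tsum_nat_add']

theorem tsum_mul_le_tsum_mul_of_monotone {p q g : ℕ → ℝ≥0∞} (h : Submajorized p q)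
    (hsum : ∑' n, q n = ∑' n, p n) (hp : ∑' n, p n ≠ ⊤) (hg : Monotone g) :
    ∑' n, q n * g n ≤ ∑' n, p n * g n := by
  obtain ⟨d, hd⟩ := exists_eq_sum_range_succ_of_monotone hg
  simp only [hd, tsum_mul_sum_range_succ]
  exact ENNReal.tsum_le_tsum fun k =>
    mul_le_mul_right (tsum_nat_add_le_of_submajorized h hsum hp k) _

end Submajorization

section TangentInequalities

variable {ι : Type*} {α : ℝ} {p r : ι → ℝ≥0∞}

/-- The `ℓ_α`-norm (a quasinorm for `α < 1`) of a family in `[0, ∞]`. -/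
def ellNorm (α : ℝ) (p : ι → ℝ≥0∞) : ℝ≥0∞ := (∑' i, p i ^ α) ^ (1 / α)

theorem ellNorm_rpow (hα : α ≠ 0) (p : ι → ℝ≥0∞) : ellNorm α p ^ α = ∑' i, p i ^ α := by
  rw [ellNorm, ← ENNReal.rpow_mul, one_div_mul_cancel hα, ENNReal.rpow_one]

theorem ellNorm_ne_zero (hα : 0 < α) (h : ∑' i, p i ≠ 0) : ellNorm α p ≠ 0 := by
  contrapose! h
  simpa [ellNorm, hα, hα.le, hα.not_gt] using h

theorem ellNorm_ne_top (hα : 1 ≤ α) (h : ∑' i, p i ≤ 1) : ellNorm α p ≠ ⊤ := by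
  refine ENNReal.rpow_ne_top_of_nonneg (by positivity) (ne_top_of_le_ne_top ENNReal.one_ne_top ?_)
  exact (ENNReal.tsum_le_tsum fun i =>
    ENNReal.rpow_le_self_of_le_one ((ENNReal.le_tsum i).trans h) hα).trans h

theorem tsum_mul_le_ellNorm_mul_ellNorm {a b : ℝ} (hab : a.HolderConjugate b)
    (p r : ι → ℝ≥0∞) : ∑' i, p i * r i ≤ ellNorm a p * ellNorm b r := by
  let : MeasurableSpace ι := ⊤
  have h := ENNReal.lintegral_mul_le_Lp_mul_Lq Measure.count hab
    (measurable_from_top (f := p)).aemeasurable (measurable_from_top (f := r)).aemeasurable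
  simpa only [lintegral_count, Pi.mul_apply, ellNorm] using h

theorem mul_rpow_sub_one (hα : 0 < α) {x : ℝ≥0∞} (hx : x ≠ ⊤) : x * x ^ (α - 1) = x ^ α := by
  rcases eq_or_ne x 0 with rfl | h0
  · simp [hα]
  · nth_rw 1 [← ENNReal.rpow_one x]
    rw [← ENNReal.rpow_add _ _ h0 hx, add_sub_cancel]

theorem tsum_mul_rpow_le_ellNorm_mul (hα : 1 < α) (p r : ι → ℝ≥0∞) :
    ∑' i, p i * r i ^ (α - 1) ≤ ellNorm α p * ellNorm α r ^ (α - 1) := by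
  have h := tsum_mul_le_ellNorm_mul_ellNorm (.conjExponent hα) p fun i => r i ^ (α - 1)
  have hα' : α - 1 ≠ 0 := (sub_pos.2 hα).ne'
  have hr : ellNorm α.conjExponent (fun i => r i ^ (α - 1)) = ellNorm α r ^ (α - 1) := by
    simp only [ellNorm, Real.conjExponent, ← ENNReal.rpow_mul, mul_div_cancel₀ _ hα']
    rw [one_div_div, one_div_mul_eq_div]
  exact h.trans_eq (by rw [hr])

theorem tsum_rpow_le_rpow_mul_rpow (h0 : 0 < α) (h1 : α < 1) (hr : ∀ i, r i ≠ ⊤)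
    (hrp : ∀ i, r i = 0 → p i = 0) :
    ∑' i, p i ^ α ≤ (∑' i, p i * r i ^ (α - 1)) ^ α * (∑' i, r i ^ α) ^ (1 - α) := by
  have h1' : 1 - α ≠ 0 := (sub_pos.2 h1).ne'
  have hconj : (1 / α).HolderConjugate (1 / (1 - α)) :=
    Real.holderConjugate_iff.2 ⟨(one_lt_div h0).2 h1, by simp⟩
  have h := tsum_mul_le_ellNorm_mul_ellNorm hconj (fun i => (p i * r i ^ (α - 1)) ^ α)
    fun i => r i ^ (α * (1 - α))
  have hterm (i : ι) : (p i * r i ^ (α - 1)) ^ α * r i ^ (α * (1 - α)) = p i ^ α := by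
    rcases eq_or_ne (r i) 0 with hi | hi
    · simp [hrp i hi, h0]
    · rw [ENNReal.mul_rpow_of_nonneg _ _ h0.le, mul_assoc, ← ENNReal.rpow_mul,
        ← ENNReal.rpow_add _ _ hi (hr i), show (α - 1) * α + α * (1 - α) = 0 by ring,
        ENNReal.rpow_zero, mul_one]
  simpa only [hterm, ellNorm, ← ENNReal.rpow_mul, mul_one_div_cancel h0.ne', ENNReal.rpow_one,
    mul_assoc, mul_one_div_cancel h1', mul_one, one_div_one_div] using h

theorem ellNorm_le_tsum_mul_rpow (h0 : 0 < α) (h1 : α < 1) (hr : ∀ i, r i ≠ ⊤)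
    (hr0 : ellNorm α r ≠ 0) :
    ellNorm α p ≤ (∑' i, p i * r i ^ (α - 1)) * ellNorm α r ^ (1 - α) := by
  by_cases hc : ∃ i, r i = 0 ∧ p i ≠ 0
  · obtain ⟨i, hri, hpi⟩ := hc
    have htop : ∑' i, p i * r i ^ (α - 1) = ⊤ := by
      refine ENNReal.tsum_eq_top_of_eq_top ⟨i, ?_⟩
      rw [hri, ENNReal.zero_rpow_of_neg (by linarith), ENNReal.mul_top hpi]
    rw [htop, ENNReal.top_mul (by simp [ENNReal.rpow_eq_zero_iff, hr0, h1.le])]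
    exact le_top
  · push Not at hc
    refine (ENNReal.rpow_le_rpow_iff h0).1 ?_
    rw [ENNReal.mul_rpow_of_nonneg _ _ h0.le, ← ENNReal.rpow_mul, mul_comm (1 - α),
      ENNReal.rpow_mul, ellNorm_rpow h0.ne', ellNorm_rpow h0.ne']
    exact tsum_rpow_le_rpow_mul_rpow h0 h1 hr hc

/-- The surprisal `-log r ∈ [0, ∞]` of an event of probability `r`, with value `∞` at `r = 0`. -/
def surprisal (r : ℝ≥0∞) : ℝ≥0∞ := (-ENNReal.log r).toENNReal

theorem antitone_surprisal : Antitone surprisal := fun _ _ h =>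
  EReal.toENNReal_le_toENNReal (EReal.neg_le_neg_iff.2 (ENNReal.log_monotone h))

theorem surprisal_zero : surprisal 0 = ⊤ := by simp [surprisal]

theorem surprisal_of_ne_zero {r : ℝ≥0∞} (h0 : r ≠ 0) (ht : r ≠ ⊤) :
    surprisal r = ENNReal.ofReal (-Real.log r.toReal) := by
  rw [surprisal, ENNReal.log_pos_real h0 ht, ← EReal.coe_neg, EReal.toENNReal_of_ne_top (by simp),
    EReal.toReal_coe]

theorem mul_surprisal {r : ℝ≥0∞} (ht : r ≠ ⊤) :
    r * surprisal r = ENNReal.ofReal (Real.negMulLog r.toReal) := by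
  rcases eq_or_ne r 0 with rfl | h0
  · simp
  · nth_rw 1 [surprisal_of_ne_zero h0 ht, ← ENNReal.ofReal_toReal ht]
    rw [← ENNReal.ofReal_mul ENNReal.toReal_nonneg, Real.negMulLog, mul_neg, neg_mul]

theorem negMulLog_add_le {a b : ℝ} (ha : 0 < a) (hb : 0 < b) :
    Real.negMulLog a + a ≤ a * -Real.log b + b := by
  have h := mul_le_mul_of_nonneg_left (Real.log_le_sub_one_of_pos (div_pos hb ha)) ha.le
  rw [Real.log_div hb.ne' ha.ne', mul_sub_one, mul_div_cancel₀ _ ha.ne'] at h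
  rw [Real.negMulLog]
  linarith

theorem ofReal_negMulLog_add_le {p r : ℝ≥0∞} (hp : p ≤ 1) (hr : r ≤ 1) :
    ENNReal.ofReal (Real.negMulLog p.toReal) + p ≤ p * surprisal r + r := by
  rcases eq_or_ne p 0 with rfl | hp0
  · simp
  rcases eq_or_ne r 0 with rfl | hr0
  · simp [surprisal_zero, ENNReal.mul_top hp0]
  have hpt := ne_top_of_le_ne_top ENNReal.one_ne_top hp
  have hrt := ne_top_of_le_ne_top ENNReal.one_ne_top hr
  have hp1 : p.toReal ≤ 1 := ENNReal.toReal_le_of_le_ofReal zero_le_one (by simpa)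
  have hr1 : r.toReal ≤ 1 := ENNReal.toReal_le_of_le_ofReal zero_le_one (by simpa)
  have hlog : 0 ≤ -Real.log r.toReal :=
    neg_nonneg.2 (Real.log_nonpos ENNReal.toReal_nonneg hr1)
  rw [surprisal_of_ne_zero hr0 hrt]
  nth_rw 2 3 [← ENNReal.ofReal_toReal hpt]
  nth_rw 2 [← ENNReal.ofReal_toReal hrt]
  rw [← ENNReal.ofReal_mul ENNReal.toReal_nonneg,
    ← ENNReal.ofReal_add (mul_nonneg ENNReal.toReal_nonneg hlog) ENNReal.toReal_nonneg,
    ← ENNReal.ofReal_add (Real.negMulLog_nonneg ENNReal.toReal_nonneg hp1) ENNReal.toReal_nonneg]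
  exact ENNReal.ofReal_le_ofReal
    (negMulLog_add_le (ENNReal.toReal_pos hp0 hpt) (ENNReal.toReal_pos hr0 hrt))

theorem tsum_negMulLog_le_tsum_mul_surprisal (hp : ∑' i, p i = 1) (hr : ∑' i, r i = 1) :
    ∑' i, ENNReal.ofReal (Real.negMulLog (p i).toReal) ≤ ∑' i, p i * surprisal (r i) := by
  have h := ENNReal.tsum_le_tsum fun i =>
    ofReal_negMulLog_add_le (hp ▸ ENNReal.le_tsum i : p i ≤ 1) (hr ▸ ENNReal.le_tsum i : r i ≤ 1)
  rw [ENNReal.tsum_add, ENNReal.tsum_add, hp, hr] at h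
  exact (ENNReal.add_le_add_iff_right ENNReal.one_ne_top).1 h

end TangentInequalities

section RandomSequences

variable {Ω : Type*} [MeasurableSpace Ω] {μ : Measure Ω} {α : ℝ} {p : Ω → ℕ → ℝ≥0∞} {r : ℕ → ℝ≥0∞}

theorem tsum_lintegral_eq_one [IsProbabilityMeasure μ] (hpm : ∀ n, Measurable (p · n))
    (hp : ∀ ω, ∑' n, p ω n = 1) : ∑' n, ∫⁻ ω, p ω n ∂μ = 1 := by
  rw [← lintegral_tsum fun n => (hpm n).aemeasurable]
  simp [hp]

theorem lintegral_tsum_mul (hpm : ∀ n, Measurable (p · n)) (g : ℕ → ℝ≥0∞) :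
    ∫⁻ ω, ∑' n, p ω n * g n ∂μ = ∑' n, (∫⁻ ω, p ω n ∂μ) * g n := by
  rw [lintegral_tsum fun n => ((hpm n).mul_const _).aemeasurable]
  exact tsum_congr fun n => lintegral_mul_const _ (hpm n)

theorem lintegral_tsum_mul_le_of_monotone [IsProbabilityMeasure μ]
    (hpm : ∀ n, Measurable (p · n)) (hp : ∀ ω, ∑' n, p ω n = 1) (hr : ∑' n, r n = 1)
    (h : Submajorized r fun n => ∫⁻ ω, p ω n ∂μ) {g : ℕ → ℝ≥0∞} (hg : Monotone g) :
    ∫⁻ ω, ∑' n, p ω n * g n ∂μ ≤ ∑' n, r n * g n := by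
  rw [lintegral_tsum_mul hpm]
  exact tsum_mul_le_tsum_mul_of_monotone h ((tsum_lintegral_eq_one hpm hp).trans hr.symm)
    (hr.trans_ne ENNReal.one_ne_top) hg

theorem lintegral_ellNorm_le_of_lt_one [IsProbabilityMeasure μ] (h0 : 0 < α) (h1 : α < 1)
    (hpm : ∀ n, Measurable (p · n)) (hp : ∀ ω, ∑' n, p ω n = 1) (hr : ∑' n, r n = 1)
    (hanti : Antitone r) (h : Submajorized r fun n => ∫⁻ ω, p ω n ∂μ) :
    ∫⁻ ω, ellNorm α (p ω) ∂μ ≤ ellNorm α r := by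
  have hrt (n : ℕ) : r n ≠ ⊤ := ENNReal.ne_top_of_tsum_ne_top (hr.trans_ne ENNReal.one_ne_top) n
  have hr0 : ellNorm α r ≠ 0 := ellNorm_ne_zero h0 (hr.trans_ne one_ne_zero)
  have hmono : Monotone fun n => r n ^ (α - 1) := fun m n hmn => by
    simp only [← neg_sub 1 α, ENNReal.rpow_neg]
    exact ENNReal.inv_le_inv.2 (ENNReal.rpow_le_rpow (hanti hmn) (sub_nonneg.2 h1.le))
  calc ∫⁻ ω, ellNorm α (p ω) ∂μ
      ≤ ∫⁻ ω, (∑' n, p ω n * r n ^ (α - 1)) * ellNorm α r ^ (1 - α) ∂μ :=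
        lintegral_mono fun ω => ellNorm_le_tsum_mul_rpow h0 h1 hrt hr0
    _ = (∫⁻ ω, ∑' n, p ω n * r n ^ (α - 1) ∂μ) * ellNorm α r ^ (1 - α) :=
        lintegral_mul_const _ (Measurable.tsum fun n => (hpm n).mul_const _)
    _ ≤ (∑' n, r n * r n ^ (α - 1)) * ellNorm α r ^ (1 - α) := by
        gcongr
        exact lintegral_tsum_mul_le_of_monotone hpm hp hr h hmono
    _ = ellNorm α r := by
        simp only [mul_rpow_sub_one h0 (hrt _)]
        rw [← ellNorm_rpow h0.ne', ← ENNReal.rpow_add_of_nonneg _ _ h0.le (sub_nonneg.2 h1.le),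
          add_sub_cancel, ENNReal.rpow_one]

theorem ellNorm_le_lintegral_of_one_lt (hα : 1 < α) (hpm : ∀ n, Measurable (p · n))
    (hrt : ellNorm α r ≠ ⊤) (hanti : Antitone r)
    (h : Submajorized r fun n => ∫⁻ ω, p ω n ∂μ) :
    ellNorm α r ≤ ∫⁻ ω, ellNorm α (p ω) ∂μ := by
  have h0 : 0 < α := one_pos.trans hα
  rcases eq_or_ne (ellNorm α r) 0 with hr0 | hr0
  · exact hr0 ▸ zero_le
  have hr (n : ℕ) : r n ≠ ⊤ := fun hn => ENNReal.ne_top_of_tsum_ne_top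
    (ellNorm_rpow h0.ne' r ▸ ENNReal.rpow_ne_top_of_nonneg h0.le hrt) n (by simp [hn, h0])
  have hmul : ellNorm α r * ellNorm α r ^ (α - 1) ≤
      (∫⁻ ω, ellNorm α (p ω) ∂μ) * ellNorm α r ^ (α - 1) := calc
    _ = ∑' n, r n * r n ^ (α - 1) := by
      simp only [mul_rpow_sub_one h0 hrt, mul_rpow_sub_one h0 (hr _), ellNorm_rpow h0.ne']
    _ ≤ ∑' n, (∫⁻ ω, p ω n ∂μ) * r n ^ (α - 1) :=
      tsum_mul_le_tsum_mul_of_antitone h fun m n hmn =>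
        ENNReal.rpow_le_rpow (hanti hmn) (sub_nonneg.2 hα.le)
    _ = ∫⁻ ω, ∑' n, p ω n * r n ^ (α - 1) ∂μ := (lintegral_tsum_mul hpm _).symm
    _ ≤ ∫⁻ ω, ellNorm α (p ω) * ellNorm α r ^ (α - 1) ∂μ :=
      lintegral_mono fun ω => tsum_mul_rpow_le_ellNorm_mul hα _ _
    _ = _ := lintegral_mul_const _
      ((Measurable.tsum fun n => (hpm n).pow_const _).pow_const _)
  exact (ENNReal.mul_le_mul_iff_left (by simp [hr0, hrt])
    (ENNReal.rpow_ne_top_of_nonneg (sub_nonneg.2 hα.le) hrt)).1 hmul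

theorem lintegral_tsum_negMulLog_le [IsProbabilityMeasure μ]
    (hpm : ∀ n, Measurable (p · n)) (hp : ∀ ω, ∑' n, p ω n = 1) (hr : ∑' n, r n = 1)
    (hanti : Antitone r) (h : Submajorized r fun n => ∫⁻ ω, p ω n ∂μ) :
    ∫⁻ ω, ∑' n, ENNReal.ofReal (Real.negMulLog (p ω n).toReal) ∂μ
      ≤ ∑' n, ENNReal.ofReal (Real.negMulLog (r n).toReal) := by
  have hrt (n : ℕ) : r n ≠ ⊤ := ENNReal.ne_top_of_tsum_ne_top (hr.trans_ne ENNReal.one_ne_top) n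
  calc ∫⁻ ω, ∑' n, ENNReal.ofReal (Real.negMulLog (p ω n).toReal) ∂μ
      ≤ ∫⁻ ω, ∑' n, p ω n * surprisal (r n) ∂μ :=
        lintegral_mono fun ω => tsum_negMulLog_le_tsum_mul_surprisal (hp ω) hr
    _ ≤ ∑' n, r n * surprisal (r n) :=
        lintegral_tsum_mul_le_of_monotone hpm hp hr h (antitone_surprisal.comp hanti)
    _ = _ := tsum_congr fun n => mul_surprisal (hrt n)

end RandomSequences

section Flattening

open Finset Filter

variable {q f : ℕ → ℝ} {L : ℕ} {v w s : ℝ}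

theorem sum_range_le_of_Ico_le {p f : ℕ → ℝ} {k m : ℕ} (hkm : k ≤ m)
    (h : ∀ i ∈ Ico k m, f i ≤ p i) (hm : ∑ i ∈ range m, p i ≤ ∑ i ∈ range m, f i) :
    ∑ i ∈ range k, p i ≤ ∑ i ∈ range k, f i := by
  rw [← sum_range_add_sum_Ico p hkm, ← sum_range_add_sum_Ico f hkm] at hm
  linarith [sum_le_sum h]

/-- The sequence obtained from `q` by raising the first `L` terms to at least `v` and cutting the
other ones down to at most `w`. -/
def flatten (q : ℕ → ℝ) (L : ℕ) (v w : ℝ) (i : ℕ) : ℝ :=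
  if i < L then max (q i) v else min (q i) w

theorem flatten_of_lt {i : ℕ} (hi : i < L) : flatten q L v w i = max (q i) v := if_pos hi

theorem flatten_of_le {i : ℕ} (hi : L ≤ i) : flatten q L v w i = min (q i) w := if_neg hi.not_gt

theorem antitone_flatten (hq : Antitone q) : Antitone (flatten q L v w) := fun i j hij => by
  rcases lt_or_ge j L with hj | hj
  · rw [flatten_of_lt hj, flatten_of_lt (hij.trans_lt hj)]
    exact max_le_max_right _ (hq hij)
  rw [flatten_of_le hj]
  rcases lt_or_ge i L with hi | hi
  · rw [flatten_of_lt hi]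
    exact (min_le_left _ _).trans ((hq hij).trans (le_max_left _ _))
  · rw [flatten_of_le hi]
    exact min_le_min_right _ (hq hij)

theorem flatten_nonneg (hq : ∀ i, 0 ≤ q i) (hw : 0 ≤ w) (i : ℕ) : 0 ≤ flatten q L v w i := by
  rcases lt_or_ge i L with hi | hi
  · exact (hq i).trans ((le_max_left _ _).trans_eq (flatten_of_lt hi).symm)
  · exact (le_min (hq i) hw).trans_eq (flatten_of_le hi).symm

theorem sum_range_max_le (hq : Antitone q) (h : Submajorized q f) {k : ℕ}
    (hf : ∀ i < k, v ≤ f i) : ∑ i ∈ range k, max (q i) v ≤ ∑ i ∈ range k, f i := by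
  induction k with
  | zero => simp
  | succ k ih =>
    rcases le_total (q k) v with hk | hk
    · rw [sum_range_succ, sum_range_succ, max_eq_right hk]
      exact add_le_add (ih fun i hi => hf i (hi.trans k.lt_succ_self)) (hf k k.lt_succ_self)
    · rw [sum_congr rfl fun i hi => max_eq_left (hk.trans (hq (mem_range_succ_iff.1 hi)))]
      exact h (k + 1)

theorem sum_range_flatten_le_of_le (hq : Antitone q) (hf : Antitone f) (h : Submajorized q f)
    (hL : ∑ i ∈ range L, flatten q L v w i ≤ ∑ i ∈ range L, f i) {k : ℕ} (hk : k ≤ L) :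
    ∑ i ∈ range k, flatten q L v w i ≤ ∑ i ∈ range k, f i := by
  rcases le_total (f k) v with hkv | hkv
  · refine sum_range_le_of_Ico_le hk (fun i hi => ?_) hL
    rw [flatten_of_lt (mem_Ico.1 hi).2]
    exact (hf (mem_Ico.1 hi).1).trans (hkv.trans (le_max_right _ _))
  · rw [sum_congr rfl fun i hi => flatten_of_lt ((mem_range.1 hi).trans_le hk)]
    exact sum_range_max_le hq h fun i hi => hkv.trans (hf hi.le)

theorem sum_range_eq_of_hasSum_of_eq {p q : ℕ → ℝ} (hp : HasSum p s) (hq : HasSum q s) {m : ℕ}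
    (h : ∀ i ≥ m, p i = q i) : ∑ i ∈ range m, p i = ∑ i ∈ range m, q i := by
  have hp' := (hasSum_nat_add_iff' m).2 hp
  simp only [h _ (Nat.le_add_left m _)] at hp'
  linarith [hp'.unique ((hasSum_nat_add_iff' m).2 hq)]

theorem sum_range_flatten_le_of_lt (hq : HasSum q s) (hp : HasSum (flatten q L v w) s)
    (hqa : Antitone q) (hf : Antitone f) (h : Submajorized q f) (hw : 0 < w) {k : ℕ}
    (hk : L ≤ k) (hkw : f k < w) :
    ∑ i ∈ range k, flatten q L v w i ≤ ∑ i ∈ range k, f i := by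
  classical
  have hex : ∃ m, k ≤ m ∧ q m ≤ w :=
    ((eventually_ge_atTop k).and
      (hq.summable.tendsto_atTop_zero.eventually_le_const hw)).exists
  obtain ⟨hkm, hm⟩ := Nat.find_spec hex
  refine sum_range_le_of_Ico_le hkm (fun i hi => ?_) ?_
  · have hi' := mem_Ico.1 hi
    have hwi : w ≤ q i := (not_le.1 fun hle => Nat.find_min hex hi'.2 ⟨hi'.1, hle⟩).le
    rw [flatten_of_le (hk.trans hi'.1), min_eq_right hwi]
    exact (hf hi'.1).trans hkw.le
  · rw [sum_range_eq_of_hasSum_of_eq hp hq fun i hi => ?_]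
    · exact h _
    · rw [flatten_of_le ((hk.trans hkm).trans hi), min_eq_left ((hqa hi).trans hm)]

theorem submajorized_flatten (hqa : Antitone q) (hq : HasSum q s)
    (hp : HasSum (flatten q L v w) s) (hf : Antitone f) (hf0 : ∀ i, 0 ≤ f i)
    (h : Submajorized q f) (hL : ∑ i ∈ range L, flatten q L v w i ≤ ∑ i ∈ range L, f i) :
    Submajorized (flatten q L v w) f := fun k => by
  rcases le_total k L with hk | hk
  · exact sum_range_flatten_le_of_le hqa hf h hL hk
  rcases lt_or_ge (f k) w with hkw | hkw
  · exact sum_range_flatten_le_of_lt hq hp hqa hf h ((hf0 k).trans_lt hkw) hk hkw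
  · rw [← sum_range_add_sum_Ico _ hk, ← sum_range_add_sum_Ico f hk]
    refine add_le_add hL (sum_le_sum fun i hi => ?_)
    rw [flatten_of_le (mem_Ico.1 hi).1]
    exact (min_le_right _ _).trans (hkw.trans (hf (mem_Ico.1 hi).2.le))

end Flattening

section FanoDistribution

open Finset Filter Topology

theorem sum_add_mul_le_sum_of_antitone {q : ℕ → ℝ} (hq : Antitone q) (m n : ℕ) :
    ∑ i ∈ range m, q i + ((n : ℝ) - m) * q n ≤ ∑ i ∈ range n, q i := by
  rcases le_total m n with h | h
  · have := card_nsmul_le_sum (Ico m n) q (q n) fun i hi => hq (mem_Ico.1 hi).2.le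
    rw [Nat.card_Ico, nsmul_eq_mul, Nat.cast_sub h] at this
    linarith [sum_range_add_sum_Ico q h]
  · have := sum_le_card_nsmul (Ico n m) q (q n) fun i hi => hq (mem_Ico.1 hi).1
    rw [Nat.card_Ico, nsmul_eq_mul, Nat.cast_sub h] at this
    linarith [sum_range_add_sum_Ico q h]

/-- The quantity whose comparison with `1 - ε` decides both defining inequalities of the Fano
distribution: `Q↓(j) < V(j)` iff it is less than `1 - ε` at `j - 1`, for `j ≤ L`, and
`W(k) < Q↓(k)` iff it is less than `1 - ε` at `k - 1`, for `k > L`. -/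
def levelSum (q : ℕ → ℝ) (L k : ℕ) : ℝ := ∑ i ∈ range k, q i + ((L : ℝ) - k) * q k

theorem sum_range_add_mul_le_levelSum {q : ℕ → ℝ} (hq : Antitone q) (L m n : ℕ) :
    ∑ i ∈ range m, q i + ((L : ℝ) - m) * q n ≤ levelSum q L n := by
  rw [levelSum]
  linarith [sum_add_mul_le_sum_of_antitone hq m n]

theorem sum_range_le_levelSum {q : ℕ → ℝ} (hq : Antitone q) (L n : ℕ) :
    ∑ i ∈ range L, q i ≤ levelSum q L n := by
  simpa using sum_range_add_mul_le_levelSum hq L L n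

theorem sum_range_le_of_frequently_levelSum_le {q : ℕ → ℝ} (hq : Antitone q)
    (h0 : Tendsto q atTop (𝓝 0)) {L : ℕ} {c : ℝ} (h : ∃ᶠ n in atTop, levelSum q L n ≤ c) (m : ℕ) :
    ∑ i ∈ range m, q i ≤ c := by
  have hlim : Tendsto (fun n => ∑ i ∈ range m, q i + ((L : ℝ) - m) * q n) atTop
      (𝓝 (∑ i ∈ range m, q i)) := by
    simpa using (h0.const_mul ((L : ℝ) - m)).const_add (∑ i ∈ range m, q i)
  exact le_of_tendsto_of_frequently hlim
    (h.mono fun n hn => (sum_range_add_mul_le_levelSum hq L m n).trans hn)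

variable (Q : PMF ℕ+) {L : ℕ} {ε : ℝ}

theorem sum_Icc_decr (k : ℕ) :
    ∑ x ∈ Icc 1 k, decr Q x = ∑ i ∈ range k, sortedMass Q i := by
  simp only [sortedMass]
  rw [range_eq_Ico, sum_Ico_add' (decr Q) 0 k 1]
  rfl

theorem weightV_succ {j : ℕ} (hj : j < L) :
    weightV Q L ε (j + 1) = ((1 - ε) - ∑ i ∈ range j, sortedMass Q i) / ((L : ℝ) - j) := by
  have hL : (L : ℝ) - (j + 1 : ℕ) + 1 = L - j := by
    push_cast
    ring
  rw [weightV, if_pos (Nat.succ_le_of_lt hj), hL, ← sum_Icc_decr]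
  rfl

theorem sortedMass_lt_weightV_iff {j : ℕ} (hj : j < L) :
    sortedMass Q j < weightV Q L ε (j + 1) ↔ levelSum (sortedMass Q) L j < 1 - ε := by
  have : (0 : ℝ) < (L : ℝ) - j := sub_pos.2 (by exact_mod_cast hj)
  rw [weightV_succ Q hj, lt_div_iff₀ this, lt_sub_iff_add_lt', levelSum, mul_comm]

theorem weightV_add_two_le_iff {j : ℕ} (hj : j + 1 < L) :
    weightV Q L ε (j + 2) ≤ sortedMass Q j ↔ 1 - ε ≤ levelSum (sortedMass Q) L j := by
  have : (0 : ℝ) < (L : ℝ) - (j + 1 : ℕ) := sub_pos.2 (by exact_mod_cast hj)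
  rw [weightV_succ Q hj, div_le_iff₀ this, sum_range_succ, levelSum, Nat.cast_succ]
  constructor <;> intro h <;> linarith

theorem weightW_of_lt {k : ℕ} (hk : L < k) :
    weightW Q L ε k = (∑ i ∈ range k, sortedMass Q i - (1 - ε)) / ((k : ℝ) - L) := by
  have h : (k : ℕ∞) ≠ L := by exact_mod_cast hk.ne'
  rw [weightW, if_neg (by simp), if_neg h, ENat.toNat_natCast, sum_Icc_decr]

theorem weightW_succ_lt_sortedMass_iff {k : ℕ} (hk : L ≤ k) :
    weightW Q L ε (k + 1 : ℕ) < sortedMass Q k ↔ levelSum (sortedMass Q) L k < 1 - ε := by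
  have : (0 : ℝ) < (k + 1 : ℕ) - (L : ℝ) := sub_pos.2 (by exact_mod_cast Nat.lt_succ_of_le hk)
  rw [weightW_of_lt Q (Nat.lt_succ_of_le hk), div_lt_iff₀ this, sum_range_succ, levelSum,
    Nat.cast_succ]
  constructor <;> intro h <;> linarith

theorem sortedMass_le_weightW_iff {k : ℕ} (hk : L < k) :
    sortedMass Q k ≤ weightW Q L ε k ↔ 1 - ε ≤ levelSum (sortedMass Q) L k := by
  have : (0 : ℝ) < (k : ℝ) - L := sub_pos.2 (by exact_mod_cast hk)
  rw [weightW_of_lt Q hk, le_div_iff₀ this, levelSum]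
  constructor <;> intro h <;> linarith

theorem sortedMass_succ_lt_one (i : ℕ) : sortedMass Q (i + 1) < 1 := by
  have h1 := sum_le_hasSum (range (i + 2)) (fun i _ => sortedMass_nonneg Q i) (hasSum_sortedMass Q)
  have h2 := sum_add_mul_le_sum_of_antitone (antitone_sortedMass Q) 0 (i + 1)
  have h3 := mul_nonneg i.cast_nonneg (sortedMass_nonneg Q (i + 1))
  rw [sum_range_succ] at h1
  rw [sum_range_zero, Nat.cast_succ, Nat.cast_zero] at h2
  linarith

theorem decr_succ_lt_weightV (hL : 1 ≤ L) : decr Q (L + 1) < weightV Q L ε (L + 1) := by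
  obtain ⟨l, rfl⟩ := Nat.exists_eq_succ_of_ne_zero (Nat.one_le_iff_ne_zero.1 hL)
  rw [weightV, if_neg (Nat.not_succ_le_self _)]
  exact sortedMass_succ_lt_one Q l

theorem indexJ_mem (hL : 1 ≤ L) :
    1 ≤ indexJ Q L ε ∧ decr Q (indexJ Q L ε) < weightV Q L ε (indexJ Q L ε) :=
  Nat.sInf_mem (s := {j | 1 ≤ j ∧ decr Q j < weightV Q L ε j})
    ⟨L + 1, L.succ_pos, decr_succ_lt_weightV Q hL⟩

theorem indexJ_le_succ (hL : 1 ≤ L) : indexJ Q L ε ≤ L + 1 :=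
  Nat.sInf_le ⟨L.succ_pos, decr_succ_lt_weightV Q hL⟩

theorem weightV_le_decr_of_lt_indexJ {j : ℕ} (h1 : 1 ≤ j) (hj : j < indexJ Q L ε) :
    weightV Q L ε j ≤ decr Q j :=
  not_lt.1 fun h => Nat.notMem_of_lt_sInf hj ⟨h1, h⟩

theorem le_indexK_of_lt {k : ℕ} (hk : L ≤ k) (h : weightW Q L ε k < decr Q k) :
    (k : ℕ∞) ≤ indexK Q L ε := le_sSup ⟨k, rfl, hk, h⟩

theorem le_indexK (hL : 1 ≤ L) : (L : ℕ∞) ≤ indexK Q L ε := by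
  obtain ⟨l, rfl⟩ := Nat.exists_eq_succ_of_ne_zero (Nat.one_le_iff_ne_zero.1 hL)
  refine le_indexK_of_lt Q le_rfl ?_
  rw [weightW, if_neg (ENat.natCast_ne_top _), if_pos rfl]
  exact neg_one_lt_zero.trans_le (sortedMass_nonneg Q l)

/-- The type-1 Fano distribution, indexed from `0` like `sortedMass`. -/
def fanoSeq (Q : PMF ℕ+) (L : ℕ) (ε : ℝ) (i : ℕ) : ℝ := fanoType1 Q L ε i.succPNat

theorem fanoSeq_eq_ite (i : ℕ) :
    fanoSeq Q L ε i = if i + 1 < indexJ Q L ε ∨ indexK Q L ε < (i + 1 : ℕ) then sortedMass Q i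
      else if i + 1 ≤ L then weightV Q L ε (indexJ Q L ε) else weightW Q L ε (indexK Q L ε) := rfl

theorem fanoSeq_eq_sortedMass_of_sum_eq (hL : 1 ≤ L)
    (h : ∑ i ∈ range L, sortedMass Q i = 1 - ε) : fanoSeq Q L ε = sortedMass Q := by
  have hlevel (n : ℕ) : ¬ levelSum (sortedMass Q) L n < 1 - ε :=
    not_lt.2 (h ▸ sum_range_le_levelSum (antitone_sortedMass Q) L n)
  have hJ : L < indexJ Q L ε := by
    obtain ⟨h1, h2⟩ := indexJ_mem Q (ε := ε) hL
    obtain ⟨j, hj⟩ := Nat.exists_eq_succ_of_ne_zero (Nat.one_le_iff_ne_zero.1 h1)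
    rw [hj] at h2 ⊢
    by_contra! hjL
    exact hlevel j ((sortedMass_lt_weightV_iff Q hjL).1 h2)
  have hK : indexK Q L ε ≤ L := by
    refine sSup_le ?_
    rintro _ ⟨k, rfl, -, hk⟩
    by_contra! hkL
    obtain ⟨k, rfl⟩ := Nat.exists_eq_add_of_lt (Nat.cast_lt.1 hkL)
    exact hlevel _ ((weightW_succ_lt_sortedMass_iff Q (Nat.le_add_right L k)).1 hk)
  funext i
  refine if_pos ((le_or_gt (i + 1) L).imp (fun hi => hi.trans_lt hJ) fun hi => ?_)
  exact hK.trans_lt (Nat.cast_lt.2 hi)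

section StrictCase

theorem indexJ_le_of_sum_lt (hL : 1 ≤ L) (h : ∑ i ∈ range L, sortedMass Q i < 1 - ε) :
    indexJ Q L ε ≤ L := by
  obtain ⟨l, rfl⟩ := Nat.exists_eq_succ_of_ne_zero (Nat.one_le_iff_ne_zero.1 hL)
  refine Nat.sInf_le ⟨hL, (sortedMass_lt_weightV_iff Q l.lt_succ_self).2 ?_⟩
  rw [levelSum]
  rw [sum_range_succ] at h
  push_cast
  linarith

theorem succ_le_indexK_of_sum_lt (h : ∑ i ∈ range L, sortedMass Q i < 1 - ε) :
    ((L + 1 : ℕ) : ℕ∞) ≤ indexK Q L ε := by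
  refine le_indexK_of_lt Q L.le_succ ((weightW_succ_lt_sortedMass_iff Q le_rfl).2 ?_)
  simpa [levelSum] using h

theorem exists_levelSum_lt_of_natCast_lt_indexK {n : ℕ} (hn : L ≤ n)
    (h : (n : ℕ∞) < indexK Q L ε) :
    ∃ m ≥ n, levelSum (sortedMass Q) L m < 1 - ε ∧ ((m + 1 : ℕ) : ℕ∞) ≤ indexK Q L ε := by
  obtain ⟨_, ⟨k, rfl, hk, hkW⟩, hnk⟩ := lt_sSup_iff.1 h
  obtain ⟨m, rfl⟩ := Nat.exists_eq_add_of_lt (Nat.cast_lt.1 hnk)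
  exact ⟨n + m, Nat.le_add_right n m,
    (weightW_succ_lt_sortedMass_iff Q (hn.trans (Nat.le_add_right n m))).1 hkW,
    le_indexK_of_lt Q hk hkW⟩

theorem levelSum_lt_of_indexK_eq {k : ℕ} (hk : L ≤ k) (hK : indexK Q L ε = (k + 1 : ℕ)) :
    levelSum (sortedMass Q) L k < 1 - ε := by
  obtain ⟨m, hm, h, hmK⟩ := exists_levelSum_lt_of_natCast_lt_indexK Q hk
    (hK ▸ Nat.cast_lt.2 k.lt_succ_self)
  rwa [le_antisymm hm (Nat.le_of_succ_le_succ (Nat.cast_le.1 (hmK.trans_eq hK)))]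

theorem sum_range_le_of_indexK_eq_top (hK : indexK Q L ε = ⊤) (m : ℕ) :
    ∑ i ∈ range m, sortedMass Q i ≤ 1 - ε := by
  refine sum_range_le_of_frequently_levelSum_le (antitone_sortedMass Q)
    (hasSum_sortedMass Q).summable.tendsto_atTop_zero (L := L)
    (frequently_atTop.2 fun a => ?_) m
  obtain ⟨n, hn, h, -⟩ := exists_levelSum_lt_of_natCast_lt_indexK Q (le_max_right a L)
    (hK ▸ ENat.natCast_lt_top _)
  exact ⟨n, (le_max_left a L).trans hn, h.le⟩

theorem weightV_indexJ_le_sortedMass (hJ : indexJ Q L ε ≤ L) {i : ℕ}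
    (hi : i + 1 < indexJ Q L ε) : weightV Q L ε (indexJ Q L ε) ≤ sortedMass Q i := by
  obtain ⟨j, hj⟩ := Nat.exists_eq_add_of_lt hi
  rw [show i + 1 + j + 1 = (i + j) + 2 by omega] at hj
  have hjL : i + j + 1 < L := by omega
  have h := weightV_le_decr_of_lt_indexJ Q (L := L) (ε := ε) (j := i + j + 1) (by omega) (by omega)
  rw [hj]
  refine ((weightV_add_two_le_iff Q hjL).2 (not_lt.1 fun h' => ?_)).trans
    (antitone_sortedMass Q (Nat.le_add_right i j))
  exact h.not_gt ((sortedMass_lt_weightV_iff Q (Nat.lt_of_succ_lt hjL)).2 h')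

theorem sortedMass_le_weightV_indexJ (hL : 1 ≤ L) {i : ℕ} (hi : indexJ Q L ε ≤ i + 1) :
    sortedMass Q i ≤ weightV Q L ε (indexJ Q L ε) := by
  obtain ⟨h1, h2⟩ := indexJ_mem Q (ε := ε) hL
  obtain ⟨j, hj⟩ := Nat.exists_eq_succ_of_ne_zero (Nat.one_le_iff_ne_zero.1 h1)
  rw [hj] at h2 hi ⊢
  exact (antitone_sortedMass Q (Nat.le_of_succ_le_succ hi)).trans h2.le

theorem lt_of_indexK_eq {k : ℕ} (h : ∑ i ∈ range L, sortedMass Q i < 1 - ε)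
    (hK : indexK Q L ε = k) : L < k :=
  Nat.cast_le.1 ((succ_le_indexK_of_sum_lt Q h).trans_eq hK)

theorem sortedMass_le_weightW_indexK (h : ∑ i ∈ range L, sortedMass Q i < 1 - ε) {i : ℕ}
    (hi : indexK Q L ε < (i + 1 : ℕ)) : sortedMass Q i ≤ weightW Q L ε (indexK Q L ε) := by
  obtain ⟨k, hK⟩ := ENat.ne_top_iff_exists.1 hi.ne_top
  rw [← hK] at hi ⊢
  have hk := lt_of_indexK_eq Q h hK.symm
  refine (antitone_sortedMass Q (Nat.le_of_lt_succ (Nat.cast_lt.1 hi))).trans ?_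
  refine (sortedMass_le_weightW_iff Q hk).2 (not_lt.1 fun hlt => ?_)
  have := le_indexK_of_lt Q (hk.le.trans k.le_succ)
    ((weightW_succ_lt_sortedMass_iff Q hk.le).2 hlt)
  exact (Nat.cast_le.1 (this.trans_eq hK.symm)).not_gt k.lt_succ_self

theorem weightW_indexK_le_sortedMass (h : ∑ i ∈ range L, sortedMass Q i < 1 - ε) {i : ℕ}
    (hi : ((i + 1 : ℕ) : ℕ∞) ≤ indexK Q L ε) :
    weightW Q L ε (indexK Q L ε) ≤ sortedMass Q i := by
  rcases eq_or_ne (indexK Q L ε) ⊤ with hK | hK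
  · rw [hK, weightW, if_pos rfl]
    exact sortedMass_nonneg Q i
  obtain ⟨k, hK⟩ := ENat.ne_top_iff_exists.1 hK
  have hk := lt_of_indexK_eq Q h hK.symm
  obtain ⟨k, rfl⟩ := Nat.exists_eq_succ_of_ne_zero (Nat.ne_zero_of_lt hk)
  have hLk := Nat.le_of_lt_succ hk
  rw [← hK] at hi ⊢
  exact ((weightW_succ_lt_sortedMass_iff Q hLk).2 (levelSum_lt_of_indexK_eq Q hLk hK.symm)).le.trans
    (antitone_sortedMass Q (Nat.le_of_succ_le_succ (Nat.cast_le.1 hi)))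

theorem fanoSeq_eq_flatten_of_sum_lt (hL : 1 ≤ L) (h : ∑ i ∈ range L, sortedMass Q i < 1 - ε) :
    fanoSeq Q L ε = flatten (sortedMass Q) L (weightV Q L ε (indexJ Q L ε))
      (weightW Q L ε (indexK Q L ε)) := by
  have hJ := indexJ_le_of_sum_lt Q hL h
  have hK := succ_le_indexK_of_sum_lt Q h
  funext i
  rw [fanoSeq_eq_ite]
  rcases lt_or_ge i L with hi | hi
  · have hiK : ¬ indexK Q L ε < (i + 1 : ℕ) :=
      not_lt.2 (le_trans (Nat.cast_le.2 (Nat.succ_le_succ hi.le)) hK)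
    rw [flatten_of_lt hi, if_pos (Nat.succ_le_of_lt hi)]
    rcases lt_or_ge (i + 1) (indexJ Q L ε) with hiJ | hiJ
    · rw [if_pos (.inl hiJ), max_eq_left (weightV_indexJ_le_sortedMass Q hJ hiJ)]
    · rw [if_neg (not_or.2 ⟨hiJ.not_gt, hiK⟩),
        max_eq_right (sortedMass_le_weightV_indexJ Q hL hiJ)]
  · have hiJ : ¬ i + 1 < indexJ Q L ε := not_lt.2 (hJ.trans (hi.trans i.le_succ))
    rw [flatten_of_le hi, if_neg (Nat.lt_succ_of_le hi).not_ge]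
    rcases lt_or_ge (indexK Q L ε) (i + 1 : ℕ) with hiK | hiK
    · rw [if_pos (.inr hiK), min_eq_left (sortedMass_le_weightW_indexK Q h hiK)]
    · rw [if_neg (not_or.2 ⟨hiJ, hiK.not_gt⟩),
        min_eq_right (weightW_indexK_le_sortedMass Q h hiK)]

theorem weightW_indexK_nonneg (h : ∑ i ∈ range L, sortedMass Q i < 1 - ε) :
    0 ≤ weightW Q L ε (indexK Q L ε) := by
  rcases eq_or_ne (indexK Q L ε) ⊤ with hK | hK
  · rw [hK, weightW, if_pos rfl]
  · obtain ⟨k, hK⟩ := ENat.ne_top_iff_exists.1 hK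
    refine (sortedMass_nonneg Q k).trans (sortedMass_le_weightW_indexK Q h ?_)
    exact hK ▸ Nat.cast_lt.2 k.lt_succ_self

theorem sum_range_fanoSeq_of_sum_lt (hL : 1 ≤ L) (h : ∑ i ∈ range L, sortedMass Q i < 1 - ε) :
    ∑ i ∈ range L, fanoSeq Q L ε i = 1 - ε := by
  have hJ := indexJ_le_of_sum_lt Q hL h
  obtain ⟨j, hj⟩ := Nat.exists_eq_succ_of_ne_zero (Nat.one_le_iff_ne_zero.1 (indexJ_mem Q hL).1)
  have hjL : j < L := Nat.lt_of_succ_le (hj ▸ hJ)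
  have hjL' : (L : ℝ) - j ≠ 0 := sub_ne_zero.2 (Nat.cast_injective.ne hjL.ne')
  have hlow : ∑ i ∈ range j, fanoSeq Q L ε i = ∑ i ∈ range j, sortedMass Q i :=
    sum_congr rfl fun i hi => if_pos (.inl (hj ▸ Nat.succ_lt_succ (mem_range.1 hi)))
  have hhigh : ∑ i ∈ Ico j L, fanoSeq Q L ε i =
      ((L : ℝ) - j) * weightV Q L ε (indexJ Q L ε) := by
    rw [← Nat.cast_sub hjL.le, ← nsmul_eq_mul, ← Nat.card_Ico]
    refine sum_eq_card_nsmul fun i hi => ?_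
    obtain ⟨hij, hiL⟩ := mem_Ico.1 hi
    rw [fanoSeq_eq_flatten_of_sum_lt Q hL h, flatten_of_lt hiL,
      max_eq_right (sortedMass_le_weightV_indexJ Q hL (hj ▸ Nat.succ_le_succ hij))]
  rw [← sum_range_add_sum_Ico _ hjL.le, hlow, hhigh, hj, Nat.succ_eq_add_one, weightV_succ Q hjL,
    mul_div_cancel₀ _ hjL', add_sub_cancel]

theorem sum_range_fanoSeq_of_indexK_eq (hL : 1 ≤ L) (h : ∑ i ∈ range L, sortedMass Q i < 1 - ε)
    {k : ℕ} (hK : indexK Q L ε = k) :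
    ∑ i ∈ range k, fanoSeq Q L ε i = ∑ i ∈ range k, sortedMass Q i := by
  have hk := lt_of_indexK_eq Q h hK
  have hk' : (k : ℝ) - L ≠ 0 := sub_ne_zero.2 (Nat.cast_injective.ne hk.ne')
  have hmid : ∑ i ∈ Ico L k, fanoSeq Q L ε i = ((k : ℝ) - L) * weightW Q L ε k := by
    rw [← Nat.cast_sub hk.le, ← nsmul_eq_mul, ← Nat.card_Ico]
    refine sum_eq_card_nsmul fun i hi => ?_
    obtain ⟨hiL, hik⟩ := mem_Ico.1 hi
    rw [fanoSeq_eq_flatten_of_sum_lt Q hL h, flatten_of_le hiL, min_eq_right, hK]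
    exact weightW_indexK_le_sortedMass Q h (hK ▸ Nat.cast_le.2 (Nat.succ_le_of_lt hik))
  rw [← sum_range_add_sum_Ico _ hk.le, sum_range_fanoSeq_of_sum_lt Q hL h, hmid,
    weightW_of_lt Q hk, mul_div_cancel₀ _ hk', add_sub_cancel]

theorem hasSum_fanoSeq_of_sum_lt (hL : 1 ≤ L) (hε : 0 ≤ ε)
    (h : ∑ i ∈ range L, sortedMass Q i < 1 - ε) : HasSum (fanoSeq Q L ε) 1 := by
  rcases eq_or_ne (indexK Q L ε) ⊤ with hK | hK
  · have hle := le_of_tendsto' (hasSum_sortedMass Q).tendsto_sum_nat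
      (sum_range_le_of_indexK_eq_top Q hK)
    have hzero (i : ℕ) (hi : i ∉ range L) : fanoSeq Q L ε i = 0 := by
      rw [fanoSeq_eq_flatten_of_sum_lt Q hL h, flatten_of_le (not_lt.1 (mem_range.not.1 hi)), hK,
        weightW, if_pos rfl, min_eq_right (sortedMass_nonneg Q i)]
    have hsum : HasSum (fanoSeq Q L ε) (∑ i ∈ range L, fanoSeq Q L ε i) :=
      hasSum_sum_of_ne_finset_zero hzero
    rwa [sum_range_fanoSeq_of_sum_lt Q hL h, show 1 - ε = 1 by linarith] at hsum
  · obtain ⟨k, hK⟩ := ENat.ne_top_iff_exists.1 hK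
    have htail (i : ℕ) : fanoSeq Q L ε (i + k) = sortedMass Q (i + k) :=
      if_pos (.inr (hK ▸ Nat.cast_lt.2 (Nat.lt_succ_of_le (Nat.le_add_left k i))))
    have hhead := sum_range_fanoSeq_of_indexK_eq Q hL h hK.symm
    refine (hasSum_nat_add_iff' k).1 ?_
    simpa only [htail, hhead] using (hasSum_nat_add_iff' k).2 (hasSum_sortedMass Q)

end StrictCase

theorem exists_fanoSeq_eq_flatten (hL : 1 ≤ L) (h : ∑ i ∈ range L, sortedMass Q i ≤ 1 - ε) :
    ∃ v w, 0 ≤ w ∧ fanoSeq Q L ε = flatten (sortedMass Q) L v w := by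
  rcases h.eq_or_lt with h | h
  · refine ⟨0, 1, zero_le_one, (fanoSeq_eq_sortedMass_of_sum_eq Q hL h).trans (funext fun i => ?_)⟩
    rcases lt_or_ge i L with hi | hi
    · rw [flatten_of_lt hi, max_eq_left (sortedMass_nonneg Q i)]
    · rw [flatten_of_le hi, min_eq_left (le_hasSum (hasSum_sortedMass Q) i fun j _ =>
        sortedMass_nonneg Q j)]
  · exact ⟨_, _, weightW_indexK_nonneg Q h, fanoSeq_eq_flatten_of_sum_lt Q hL h⟩

theorem sum_range_fanoSeq (hL : 1 ≤ L) (h : ∑ i ∈ range L, sortedMass Q i ≤ 1 - ε) :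
    ∑ i ∈ range L, fanoSeq Q L ε i = 1 - ε := by
  rcases h.eq_or_lt with h | h
  · rw [fanoSeq_eq_sortedMass_of_sum_eq Q hL h, h]
  · exact sum_range_fanoSeq_of_sum_lt Q hL h

theorem hasSum_fanoSeq (hL : 1 ≤ L) (hε : 0 ≤ ε) (h : ∑ i ∈ range L, sortedMass Q i ≤ 1 - ε) :
    HasSum (fanoSeq Q L ε) 1 := by
  rcases h.eq_or_lt with h | h
  · rw [fanoSeq_eq_sortedMass_of_sum_eq Q hL h]
    exact hasSum_sortedMass Q
  · exact hasSum_fanoSeq_of_sum_lt Q hL hε h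

theorem antitone_fanoSeq (hL : 1 ≤ L) (h : ∑ i ∈ range L, sortedMass Q i ≤ 1 - ε) :
    Antitone (fanoSeq Q L ε) := by
  obtain ⟨v, w, -, hvw⟩ := exists_fanoSeq_eq_flatten Q hL h
  exact hvw ▸ antitone_flatten (antitone_sortedMass Q)

theorem fanoSeq_nonneg (hL : 1 ≤ L) (h : ∑ i ∈ range L, sortedMass Q i ≤ 1 - ε) (i : ℕ) :
    0 ≤ fanoSeq Q L ε i := by
  obtain ⟨v, w, hw, hvw⟩ := exists_fanoSeq_eq_flatten Q hL h
  exact hvw ▸ flatten_nonneg (sortedMass_nonneg Q) hw i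

theorem submajorized_fanoSeq (hL : 1 ≤ L) (hε : 0 ≤ ε)
    (h : ∑ i ∈ range L, sortedMass Q i ≤ 1 - ε) {f : ℕ → ℝ} (hf : Antitone f)
    (hf0 : ∀ i, 0 ≤ f i) (hQf : Submajorized (sortedMass Q) f)
    (hfL : 1 - ε ≤ ∑ i ∈ range L, f i) : Submajorized (fanoSeq Q L ε) f := by
  have hsum := hasSum_fanoSeq Q hL hε h
  have hhead := (sum_range_fanoSeq Q hL h).trans_le hfL
  obtain ⟨v, w, -, hvw⟩ := exists_fanoSeq_eq_flatten Q hL h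
  rw [hvw] at hsum hhead ⊢
  exact submajorized_flatten (antitone_sortedMass Q) (hasSum_sortedMass Q) hsum hf hf0 hQf hhead

end FanoDistribution

section FanoDistributionSums

theorem tsum_eq_tsum_add_tsum_add_tsum_compl {ι : Type*} (φ : ι → ℝ≥0∞) {s t : Set ι}
    (h : Disjoint s t) :
    ∑' x, φ x = ∑' x : s, φ x + ∑' x : t, φ x + ∑' x : ↥(s ∪ t)ᶜ, φ x := by
  rw [← ENNReal.summable.tsum_union_disjoint h ENNReal.summable,
    ENNReal.summable.tsum_add_tsum_compl ENNReal.summable]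

theorem encard_setOf_lt_le (a : ℕ) (K : ℕ∞) :
    {x : ℕ+ | a < (x : ℕ) ∧ ((x : ℕ) : ℕ∞) ≤ K}.encard = K - a := by
  have hinj : Function.Injective fun i : ℕ => (a + i).succPNat :=
    Nat.succPNat_injective.comp (add_right_injective a)
  rw [← encard_setOf_natCast_succ_le (K - a), ← hinj.encard_image]
  congr 1
  ext x
  have hle (i : ℕ) : ((i + 1 : ℕ) : ℕ∞) ≤ K - a ↔ (((a + i).succPNat : ℕ) : ℕ∞) ≤ K := by
    rw [Nat.succPNat_coe]
    induction K using ENat.recTopCoe with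
    | top => simp
    | coe k =>
      norm_cast
      omega
  constructor
  · rintro ⟨hax, hxK⟩
    obtain ⟨i, hi⟩ := Nat.exists_eq_add_of_lt hax
    have hx : (a + i).succPNat = x := PNat.eq hi.symm
    exact ⟨i, (hle i).2 (hx ▸ hxK), hx⟩
  · rintro ⟨i, hi, rfl⟩
    exact ⟨Nat.lt_succ_of_le (Nat.le_add_right a i), (hle i).1 hi⟩

variable (Q : PMF ℕ+) {L : ℕ} {ε : ℝ}

theorem tsum_fanoType1_indexJ_le (hL : 1 ≤ L) (F : ℝ → ℝ≥0∞) :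
    ∑' x : {x : ℕ+ | indexJ Q L ε ≤ x ∧ (x : ℕ) ≤ L}, F (fanoType1 Q L ε x) =
      ((L + 1 - indexJ Q L ε : ℕ) : ℝ≥0∞) * F (weightV Q L ε (indexJ Q L ε)) := by
  obtain ⟨j, hj⟩ := Nat.exists_eq_succ_of_ne_zero
    (Nat.one_le_iff_ne_zero.1 (indexJ_mem Q (ε := ε) hL).1)
  have hval (x : {x : ℕ+ | indexJ Q L ε ≤ x ∧ (x : ℕ) ≤ L}) :
      F (fanoType1 Q L ε x) = F (weightV Q L ε (indexJ Q L ε)) := by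
    have hxK := (Nat.cast_le.2 x.2.2).trans (le_indexK Q (ε := ε) hL)
    rw [fanoType1, if_neg (not_or.2 ⟨x.2.1.not_gt, hxK.not_gt⟩), if_pos x.2.2]
  have hcard := encard_setOf_lt_le j L
  simp only [Nat.cast_le] at hcard
  rw [tsum_congr hval, ENNReal.tsum_set_const, hj]
  simp only [Nat.succ_le_iff, hcard, Nat.succ_eq_add_one, Nat.add_sub_add_right]
  norm_cast

theorem tsum_fanoType1_le_indexK (hL : 1 ≤ L) (F : ℝ → ℝ≥0∞) :
    ∑' x : {x : ℕ+ | L < x ∧ ((x : ℕ) : ℕ∞) ≤ indexK Q L ε}, F (fanoType1 Q L ε x) =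
      ((indexK Q L ε - (L : ℕ∞) : ℕ∞) : ℝ≥0∞) * F (weightW Q L ε (indexK Q L ε)) := by
  rw [← encard_setOf_lt_le, ← ENNReal.tsum_set_const]
  refine tsum_congr fun x => ?_
  have hxJ := (indexJ_le_succ Q (ε := ε) hL).trans x.2.1
  rw [fanoType1, if_neg (not_or.2 ⟨hxJ.not_gt, x.2.2.not_gt⟩), if_neg x.2.1.not_ge]

theorem tsum_fanoType1 (hL : 1 ≤ L) (F : ℝ → ℝ≥0∞) :
    ∑' x, F (fanoType1 Q L ε x) =
      ((L + 1 - indexJ Q L ε : ℕ) : ℝ≥0∞) * F (weightV Q L ε (indexJ Q L ε))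
        + ((indexK Q L ε - (L : ℕ∞) : ℕ∞) : ℝ≥0∞) * F (weightW Q L ε (indexK Q L ε))
        + ∑' x : {x : ℕ+ // (x : ℕ) < indexJ Q L ε ∨ indexK Q L ε < ((x : ℕ) : ℕ∞)},
            F (decr Q (x : ℕ+)) := by
  have hJ := indexJ_le_succ Q (ε := ε) hL
  have hK := le_indexK Q (ε := ε) hL
  have hdisj : Disjoint {x : ℕ+ | indexJ Q L ε ≤ x ∧ (x : ℕ) ≤ L}
      {x : ℕ+ | L < x ∧ ((x : ℕ) : ℕ∞) ≤ indexK Q L ε} :=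
    Set.disjoint_left.2 fun x hx hx' => hx.2.not_gt hx'.1
  have hcompl : ({x : ℕ+ | indexJ Q L ε ≤ x ∧ (x : ℕ) ≤ L} ∪
      {x : ℕ+ | L < x ∧ ((x : ℕ) : ℕ∞) ≤ indexK Q L ε})ᶜ =
      {x : ℕ+ | (x : ℕ) < indexJ Q L ε ∨ indexK Q L ε < ((x : ℕ) : ℕ∞)} := by
    ext x
    have hJx : L < x → indexJ Q L ε ≤ x := fun hx => hJ.trans hx
    have hKx : (x : ℕ) ≤ L → ((x : ℕ) : ℕ∞) ≤ indexK Q L ε :=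
      fun hx => (Nat.cast_le.2 hx).trans hK
    simp only [Set.mem_compl_iff, Set.mem_union, Set.mem_ofPred_eq, ← not_le]
    rw [← not_le] at hJx
    tauto
  rw [tsum_eq_tsum_add_tsum_add_tsum_compl _ hdisj, tsum_fanoType1_indexJ_le Q hL,
    tsum_fanoType1_le_indexK Q hL, hcompl]
  exact congrArg _ (tsum_congr fun x => congrArg F (if_pos x.2))

theorem shannon_fanoType1_one (h : ∑ i ∈ Finset.range 1, sortedMass Q i ≤ 1 - ε) :
    shannon (fanoType1 Q 1 ε) = ENNReal.ofReal (Real.negMulLog (1 - ε))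
      + ((indexK Q 1 ε - 1 : ℕ∞) : ℝ≥0∞)
        * ENNReal.ofReal (Real.negMulLog (weightW Q 1 ε (indexK Q 1 ε)))
      + ∑' x : {x : ℕ+ // indexK Q 1 ε < ((x : ℕ) : ℕ∞)},
          ENNReal.ofReal (Real.negMulLog (decr Q (x : ℕ+))) := by
  have hone : fanoType1 Q 1 ε 1 = 1 - ε :=
    (Finset.sum_range_one (fanoSeq Q 1 ε)).symm.trans (sum_range_fanoSeq Q le_rfl h)
  have hK := le_indexK Q (ε := ε) le_rfl
  have hdisj : Disjoint {(1 : ℕ+)} {x : ℕ+ | 1 < (x : ℕ) ∧ ((x : ℕ) : ℕ∞) ≤ indexK Q 1 ε} :=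
    Set.disjoint_singleton_left.2 fun hx => hx.1.false
  have hcompl : ({(1 : ℕ+)} ∪ {x : ℕ+ | 1 < (x : ℕ) ∧ ((x : ℕ) : ℕ∞) ≤ indexK Q 1 ε})ᶜ =
      {x : ℕ+ | indexK Q 1 ε < ((x : ℕ) : ℕ∞)} := by
    ext x
    rcases eq_or_ne x 1 with rfl | hx
    · simpa [Order.one_le_iff_ne_zero] using hK
    · have hx1 : 1 < (x : ℕ) := (PNat.coe_lt_coe 1 x).2 (one_lt_iff_ne_one.2 hx)
      simp [hx, hx1]
  rw [shannon, tsum_eq_tsum_add_tsum_add_tsum_compl _ hdisj, tsum_singleton (1 : ℕ+)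
      fun x => ENNReal.ofReal (Real.negMulLog (fanoType1 Q 1 ε x)), hone, hcompl,
    tsum_fanoType1_le_indexK Q le_rfl fun u => ENNReal.ofReal (Real.negMulLog u), Nat.cast_one]
  refine congrArg _ (tsum_congr fun x => ?_)
  rw [fanoType1, if_pos (.inr x.2)]

end FanoDistributionSums

section Averaging

variable {Ω 𝒴 : Type*} [MeasurableSpace Ω] [MeasurableSpace 𝒴]

theorem natCast_succ_le_encard_iff {α : Type*} (s : Set α) (n : ℕ) :
    ((n + 1 : ℕ) : ℕ∞) ≤ s.encard ↔ ∃ S : Finset α, S.card = n + 1 ∧ ∀ x ∈ S, x ∈ s := by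
  constructor
  · intro h
    obtain ⟨S, hS, hcard⟩ := Set.exists_subset_encard_eq h
    lift S to Finset α using Set.finite_of_encard_eq_coe hcard
    rw [Set.encard_coe_eq_coe_finsetCard] at hcard
    exact ⟨S, Nat.cast_injective hcard, hS⟩
  · rintro ⟨S, hcard, hS⟩
    rw [← hcard, ← Set.encard_coe_eq_coe_finsetCard]
    exact Set.encard_le_encard hS

theorem measurable_sortedMass_toPMF (κ : Kernel 𝒴 ℕ+) [IsMarkovKernel κ] (n : ℕ) :
    Measurable fun y => sortedMass (κ y).toPMF n := by
  refine measurable_of_Ioi fun t => ?_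
  rcases lt_or_ge t 0 with ht | ht
  · convert MeasurableSet.univ
    exact Set.eq_univ_of_forall fun y => ht.trans_le (sortedMass_nonneg _ n)
  · have hset : (fun y => sortedMass (κ y).toPMF n) ⁻¹' Set.Ioi t =
        ⋃ S : {S : Finset ℕ+ // S.card = n + 1}, ⋂ x ∈ S.1, {y | t < (κ y {x}).toReal} := by
      ext y
      simp only [Set.mem_preimage, Set.mem_Ioi, Set.mem_iUnion, Set.mem_iInter,
        lt_sortedMass_iff _ ht, natCast_succ_le_encard_iff, Subtype.exists, exists_prop]
      rfl
    rw [hset]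
    refine MeasurableSet.iUnion fun S => Finset.measurableSet_biInter _ fun x _ => ?_
    exact measurableSet_lt measurable_const
      (Kernel.measurable_coe κ (measurableSet_singleton x)).ennreal_toReal

theorem measure_finset_le_sum_sortedMass (ν : Measure ℕ+) [IsProbabilityMeasure ν]
    {S : Finset ℕ+} {k : ℕ} (hS : S.card ≤ k) :
    ν S ≤ ∑ n ∈ Finset.range k, ENNReal.ofReal (sortedMass ν.toPMF n) := by
  rw [← ENNReal.ofReal_sum_of_nonneg fun n _ => sortedMass_nonneg _ n]
  calc ν S = ENNReal.ofReal (∑ x ∈ S, (ν.toPMF x).toReal) := by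
        rw [← sum_measure_singleton, ENNReal.ofReal_sum_of_nonneg fun x _ => ENNReal.toReal_nonneg]
        exact Finset.sum_congr rfl fun x _ => (ENNReal.ofReal_toReal (measure_ne_top ν _)).symm
    _ ≤ _ := ENNReal.ofReal_le_ofReal (sum_mass_le_sum_sortedMass _ hS)

theorem measurableSet_setOf_mem_list {f : 𝒴 → Finset ℕ+}
    (hf : ∀ x, MeasurableSet {y | x ∈ f y}) : MeasurableSet {z : 𝒴 × ℕ+ | z.2 ∈ f z.1} := by
  have h : {z : 𝒴 × ℕ+ | z.2 ∈ f z.1} = ⋃ x : ℕ+, {y | x ∈ f y} ×ˢ {x} := by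
    ext ⟨y, x⟩
    simp
  rw [h]
  exact MeasurableSet.iUnion fun x => (hf x).prod (measurableSet_singleton x)

variable (μ : Measure Ω) [IsProbabilityMeasure μ] {X : Ω → ℕ+} {Y : Ω → 𝒴}

/-- The decreasing rearrangement of the conditional law of `X` given `Y`, indexed from `0`. -/
def sortedCondLaw (X : Ω → ℕ+) (Y : Ω → 𝒴) (ω : Ω) (n : ℕ) : ℝ≥0∞ :=
  ENNReal.ofReal (sortedMass (condDistrib X Y μ (Y ω)).toPMF n)

/-- The expectation `𝔼[P_{X|Y}↓]` of the rearranged conditional law, indexed from `0`. -/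
def meanSortedLaw (X : Ω → ℕ+) (Y : Ω → 𝒴) (n : ℕ) : ℝ :=
  (∫⁻ ω, sortedCondLaw μ X Y ω n ∂μ).toReal

theorem measurable_sortedCondLaw (hY : Measurable Y) (n : ℕ) :
    Measurable fun ω => sortedCondLaw μ X Y ω n :=
  ((measurable_sortedMass_toPMF (condDistrib X Y μ) n).comp hY).ennreal_ofReal

theorem tsum_sortedCondLaw (ω : Ω) : ∑' n, sortedCondLaw μ X Y ω n = 1 := by
  have h := hasSum_sortedMass (condDistrib X Y μ (Y ω)).toPMF
  rw [← ENNReal.ofReal_one, ← h.tsum_eq]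
  exact (ENNReal.ofReal_tsum_of_nonneg (sortedMass_nonneg _) h.summable).symm

theorem powerSum_condLaw {α : ℝ} (hα : 0 < α) (ω : Ω) :
    powerSum α (condLaw μ X Y ω) = ∑' n, sortedCondLaw μ X Y ω n ^ α :=
  tsum_comp_mass_eq_tsum_sortedMass (condDistrib X Y μ (Y ω)).toPMF
    (F := fun u => ENNReal.ofReal u ^ α) (by simp [hα])

theorem shannon_condLaw (ω : Ω) :
    shannon (condLaw μ X Y ω) =
      ∑' n, ENNReal.ofReal (Real.negMulLog (sortedCondLaw μ X Y ω n).toReal) := by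
  simp only [sortedCondLaw, ENNReal.toReal_ofReal (sortedMass_nonneg _ _)]
  exact tsum_comp_mass_eq_tsum_sortedMass (condDistrib X Y μ (Y ω)).toPMF
    (F := fun u => ENNReal.ofReal (Real.negMulLog u)) (by simp)

theorem ofReal_meanSortedLaw (n : ℕ) :
    ENNReal.ofReal (meanSortedLaw μ X Y n) = ∫⁻ ω, sortedCondLaw μ X Y ω n ∂μ := by
  have hle (ω : Ω) : sortedCondLaw μ X Y ω n ≤ 1 :=
    (ENNReal.le_tsum n).trans_eq (tsum_sortedCondLaw μ ω)
  refine ENNReal.ofReal_toReal (ne_top_of_le_ne_top ENNReal.one_ne_top ?_)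
  simpa using lintegral_mono (μ := μ) hle

theorem meanSortedLaw_nonneg (n : ℕ) : 0 ≤ meanSortedLaw μ X Y n := ENNReal.toReal_nonneg

theorem antitone_meanSortedLaw : Antitone (meanSortedLaw μ X Y) := fun m n hmn => by
  refine (ENNReal.ofReal_le_ofReal_iff (meanSortedLaw_nonneg μ m)).1 ?_
  rw [ofReal_meanSortedLaw, ofReal_meanSortedLaw]
  exact lintegral_mono fun ω => ENNReal.ofReal_le_ofReal (antitone_sortedMass _ hmn)

theorem measureReal_mem_list_le (hX : Measurable X) (hY : Measurable Y) {f : 𝒴 → Finset ℕ+}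
    (hf : ∀ x, MeasurableSet {y | x ∈ f y}) {k : ℕ} (hk : ∀ y, (f y).card ≤ k) :
    μ.real {ω | X ω ∈ f (Y ω)} ≤ ∑ n ∈ Finset.range k, meanSortedLaw μ X Y n := by
  have hs := measurableSet_setOf_mem_list hf
  have hm (n : ℕ) := (measurable_sortedMass_toPMF (condDistrib X Y μ) n).ennreal_ofReal
  refine ENNReal.toReal_le_of_le_ofReal (Finset.sum_nonneg fun n _ => meanSortedLaw_nonneg μ n) ?_
  rw [ENNReal.ofReal_sum_of_nonneg fun n _ => meanSortedLaw_nonneg μ n]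
  simp only [ofReal_meanSortedLaw]
  calc μ {ω | X ω ∈ f (Y ω)}
      = (μ.map fun ω => (Y ω, X ω)) {z : 𝒴 × ℕ+ | z.2 ∈ f z.1} :=
        (Measure.map_apply (hY.prodMk hX) hs).symm
    _ = ∫⁻ y, condDistrib X Y μ y (f y) ∂(μ.map Y) := by
        rw [← compProd_map_condDistrib hX.aemeasurable, Measure.compProd_apply hs]
        rfl
    _ ≤ ∫⁻ y, ∑ n ∈ Finset.range k,
          ENNReal.ofReal (sortedMass (condDistrib X Y μ y).toPMF n) ∂(μ.map Y) :=
        lintegral_mono fun y => measure_finset_le_sum_sortedMass _ (hk y)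
    _ = ∑ n ∈ Finset.range k, ∫⁻ y,
          ENNReal.ofReal (sortedMass (condDistrib X Y μ y).toPMF n) ∂(μ.map Y) :=
        lintegral_finsetSum _ fun n _ => hm n
    _ = ∑ n ∈ Finset.range k, ∫⁻ ω, sortedCondLaw μ X Y ω n ∂μ :=
        Finset.sum_congr rfl fun n _ => lintegral_map (hm n) hY

theorem submajorized_sortedMass_meanSortedLaw (hX : Measurable X) (hY : Measurable Y)
    {Q : PMF ℕ+} (hQ : μ.map X = Q.toMeasure) :
    Submajorized (sortedMass Q) (meanSortedLaw μ X Y) := by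
  intro k
  obtain ⟨S, hS, hsum⟩ := exists_sum_mass_eq_sum_sortedMass Q k
  have hprob : μ.real (X ⁻¹' S) = ∑ x ∈ S, (Q x).toReal := by
    rw [Measure.real, ← Measure.map_apply hX S.measurableSet, hQ, Q.toMeasure_apply_finset,
      ENNReal.toReal_sum fun x _ => Q.apply_ne_top x]
  rw [← hsum, ← hprob]
  exact measureReal_mem_list_le μ hX hY (f := fun _ => S) (fun x => MeasurableSet.const _)
    fun _ => hS

theorem one_sub_listError_le (hX : Measurable X) (hY : Measurable Y) {L : ℕ} (hL : 1 ≤ L) :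
    1 - listError L μ X Y ≤ ∑ n ∈ Finset.range L, meanSortedLaw μ X Y n := by
  have hconst : IsListDecoder L fun _ : 𝒴 => ({1} : Finset ℕ+) :=
    ⟨fun _ => ⟨le_rfl, hL⟩, fun _ => MeasurableSet.const _⟩
  rw [sub_le_comm]
  refine le_csInf ⟨_, _, hconst, rfl⟩ ?_
  rintro _ ⟨f, ⟨hcard, hf⟩, rfl⟩
  have hmem : MeasurableSet {ω | X ω ∈ f (Y ω)} :=
    (hY.prodMk hX) (measurableSet_setOf_mem_list hf)
  calc 1 - ∑ n ∈ Finset.range L, meanSortedLaw μ X Y n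
      ≤ 1 - μ.real {ω | X ω ∈ f (Y ω)} :=
        sub_le_sub_left (measureReal_mem_list_le μ hX hY hf fun y => (hcard y).2) 1
    _ = μ.real {ω | X ω ∉ f (Y ω)} := (probReal_compl_eq_one_sub hmem).symm

end Averaging

section FanoInequality

theorem coe_mul_log_le_of_nonneg {c : ℝ} (hc : 0 ≤ c) {a b : ℝ≥0∞} (h : a ≤ b) :
    (c : EReal) * ENNReal.log a ≤ c * ENNReal.log b :=
  mul_le_mul_of_nonneg_left (ENNReal.log_le_log h) (EReal.coe_nonneg.2 hc)

theorem coe_mul_log_le_of_nonpos {c : ℝ} (hc : c ≤ 0) {a b : ℝ≥0∞} (h : b ≤ a) :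
    (c : EReal) * ENNReal.log a ≤ c * ENNReal.log b := by
  rw [mul_comm _ (ENNReal.log a), mul_comm _ (ENNReal.log b)]
  exact EReal.mul_le_mul_of_nonpos_right (ENNReal.log_le_log h) (EReal.coe_nonpos.2 hc)

theorem coe_mul_log_rpow (c s : ℝ) (a : ℝ≥0∞) :
    (c : EReal) * ENNReal.log (a ^ s) = ((c * s : ℝ) : EReal) * ENNReal.log a := by
  rw [ENNReal.log_rpow, ← mul_assoc, ← EReal.coe_mul]

theorem rpow_lintegral_le_lintegral_rpow {Ω : Type*} [MeasurableSpace Ω] {μ : Measure Ω}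
    [IsProbabilityMeasure μ] {f : Ω → ℝ≥0∞} (hf : Measurable f) {s : ℝ} (hs : 1 < s) :
    (∫⁻ ω, f ω ∂μ) ^ s ≤ ∫⁻ ω, f ω ^ s ∂μ := by
  have hs0 : 0 < s := zero_lt_one.trans hs
  have h := ENNReal.lintegral_mul_le_Lp_mul_Lq μ (Real.HolderConjugate.conjExponent hs)
    hf.aemeasurable (aemeasurable_const (b := (1 : ℝ≥0∞)))
  simp only [Pi.mul_apply, mul_one, ENNReal.one_rpow, lintegral_const, measure_univ] at h
  rwa [one_div, ENNReal.le_rpow_inv_iff hs0] at h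

variable {Ω 𝒴 : Type*} [MeasurableSpace Ω] [MeasurableSpace 𝒴]
  (μ : Measure Ω) [IsProbabilityMeasure μ] {X : Ω → ℕ+} {Y : Ω → 𝒴} {Q : PMF ℕ+} {L : ℕ} {ε : ℝ}

theorem alphaNorm_condLaw {α : ℝ} (hα : 0 < α) (ω : Ω) :
    alphaNorm α (condLaw μ X Y ω) = ellNorm α (sortedCondLaw μ X Y ω) := by
  rw [alphaNorm, powerSum_condLaw μ hα, ellNorm]

theorem measurable_alphaNorm_condLaw (hY : Measurable Y) {α : ℝ} (hα : 0 < α) :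
    Measurable fun ω => alphaNorm α (condLaw μ X Y ω) := by
  simp only [alphaNorm, powerSum_condLaw μ hα]
  exact (Measurable.tsum fun n => (measurable_sortedCondLaw μ hY n).pow_const α).pow_const _

theorem condRenyi_hayashi_le_arimoto (hY : Measurable Y) {α : ℝ} (hα : 0 < α) :
    condRenyi Kind.hayashi α μ X Y ≤ condRenyi Kind.arimoto α μ X Y := by
  by_cases h1 : α = 1
  · simp only [condRenyi, if_pos h1, le_refl]
  have hm := measurable_alphaNorm_condLaw μ (X := X) hY hα
  have hexp : α / (1 - α) = 1 / (1 - α) * α := (one_div_mul_eq_div _ _).symm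
  simp only [condRenyi, if_neg h1, hexp, ← coe_mul_log_rpow]
  rcases lt_or_gt_of_ne h1 with h | h
  · refine coe_mul_log_le_of_nonneg (one_div_nonneg.2 (sub_nonneg.2 h.le)) ?_
    have hjensen := rpow_lintegral_le_lintegral_rpow (μ := μ) (hm.pow_const α)
      ((one_lt_inv₀ hα).2 h)
    simp only [ENNReal.rpow_rpow_inv hα.ne'] at hjensen
    exact (ENNReal.rpow_inv_le_iff hα).1 hjensen
  · exact coe_mul_log_le_of_nonpos (one_div_nonpos.2 (sub_nonpos.2 h.le))
      (rpow_lintegral_le_lintegral_rpow hm h)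

theorem submajorized_fanoSeq_lintegral (hL : 1 ≤ L) (hε : 0 ≤ ε)
    (h : ∑ i ∈ Finset.range L, sortedMass Q i ≤ 1 - ε) (hX : Measurable X) (hY : Measurable Y)
    (herr : listError L μ X Y ≤ ε) (hQ : μ.map X = Q.toMeasure) :
    Submajorized (fun n => ENNReal.ofReal (fanoSeq Q L ε n))
      fun n => ∫⁻ ω, sortedCondLaw μ X Y ω n ∂μ := by
  simp only [← ofReal_meanSortedLaw]
  exact submajorized_ofReal (fanoSeq_nonneg Q hL h) (meanSortedLaw_nonneg μ)
    (submajorized_fanoSeq Q hL hε h (antitone_meanSortedLaw μ) (meanSortedLaw_nonneg μ)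
      (submajorized_sortedMass_meanSortedLaw μ hX hY hQ)
      ((sub_le_sub_left herr 1).trans (one_sub_listError_le μ hX hY hL)))

theorem tsum_ofReal_fanoSeq (hL : 1 ≤ L) (hε : 0 ≤ ε)
    (h : ∑ i ∈ Finset.range L, sortedMass Q i ≤ 1 - ε) :
    ∑' n, ENNReal.ofReal (fanoSeq Q L ε n) = 1 := by
  have hsum := hasSum_fanoSeq Q hL hε h
  rw [← ENNReal.ofReal_tsum_of_nonneg (fanoSeq_nonneg Q hL h) hsum.summable, hsum.tsum_eq,
    ENNReal.ofReal_one]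

theorem antitone_ofReal_fanoSeq (hL : 1 ≤ L)
    (h : ∑ i ∈ Finset.range L, sortedMass Q i ≤ 1 - ε) :
    Antitone fun n => ENNReal.ofReal (fanoSeq Q L ε n) :=
  fun _ _ hmn => ENNReal.ofReal_le_ofReal (antitone_fanoSeq Q hL h hmn)

theorem tsum_pnat_eq_tsum_succPNat (φ : ℕ+ → ℝ≥0∞) : ∑' x, φ x = ∑' i : ℕ, φ i.succPNat :=
  (Equiv.pnatEquivNat.symm.tsum_eq φ).symm

theorem condShannon_le_shannon_fanoType1 (hL : 1 ≤ L) (hε : 0 ≤ ε)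
    (h : ∑ i ∈ Finset.range L, sortedMass Q i ≤ 1 - ε) (hX : Measurable X) (hY : Measurable Y)
    (herr : listError L μ X Y ≤ ε) (hQ : μ.map X = Q.toMeasure) :
    condShannon μ X Y ≤ shannon (fanoType1 Q L ε) := by
  simp only [condShannon, shannon_condLaw]
  refine (lintegral_tsum_negMulLog_le (measurable_sortedCondLaw μ hY) (tsum_sortedCondLaw μ)
    (tsum_ofReal_fanoSeq hL hε h) (antitone_ofReal_fanoSeq hL h)
    (submajorized_fanoSeq_lintegral μ hL hε h hX hY herr hQ)).trans_eq ?_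
  simp only [ENNReal.toReal_ofReal (fanoSeq_nonneg Q hL h _)]
  exact (tsum_pnat_eq_tsum_succPNat fun x =>
    ENNReal.ofReal (Real.negMulLog (fanoType1 Q L ε x))).symm

theorem alphaNorm_fanoType1 (α : ℝ) :
    alphaNorm α (fanoType1 Q L ε) = ellNorm α fun n => ENNReal.ofReal (fanoSeq Q L ε n) :=
  congrArg (· ^ (1 / α)) (tsum_pnat_eq_tsum_succPNat _)

theorem renyi_eq_log_alphaNorm {α : ℝ} (h0 : α ≠ 0) (h1 : α ≠ 1) (P : ℕ+ → ℝ) :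
    renyi α P = ((α / (1 - α) : ℝ) : EReal) * ENNReal.log (alphaNorm α P) := by
  rw [renyi, if_neg h1, alphaNorm, coe_mul_log_rpow, div_mul_div_comm, mul_one, mul_comm (1 - α),
    div_mul_cancel_left₀ h0, one_div]

theorem condRenyi_arimoto_le_renyi_fanoType1 (hL : 1 ≤ L) (hε : 0 ≤ ε)
    (h : ∑ i ∈ Finset.range L, sortedMass Q i ≤ 1 - ε) (hX : Measurable X) (hY : Measurable Y)
    (herr : listError L μ X Y ≤ ε) (hQ : μ.map X = Q.toMeasure) {α : ℝ} (hα : 0 < α) :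
    condRenyi Kind.arimoto α μ X Y ≤ renyi α (fanoType1 Q L ε) := by
  by_cases h1 : α = 1
  · rw [condRenyi, renyi, if_pos h1, if_pos h1, EReal.coe_ennreal_le_coe_ennreal_iff]
    exact condShannon_le_shannon_fanoType1 μ hL hε h hX hY herr hQ
  have hm := measurable_sortedCondLaw μ (X := X) hY
  have hsum := tsum_ofReal_fanoSeq hL hε h
  have hanti := antitone_ofReal_fanoSeq hL h
  have hmaj := submajorized_fanoSeq_lintegral μ hL hε h hX hY herr hQ
  rw [renyi_eq_log_alphaNorm hα.ne' h1, alphaNorm_fanoType1]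
  simp only [condRenyi, if_neg h1, alphaNorm_condLaw μ hα]
  rcases lt_or_gt_of_ne h1 with hlt | hgt
  · exact coe_mul_log_le_of_nonneg (div_nonneg hα.le (sub_nonneg.2 hlt.le))
      (lintegral_ellNorm_le_of_lt_one hα hlt hm (tsum_sortedCondLaw μ) hsum hanti hmaj)
  · exact coe_mul_log_le_of_nonpos (div_nonpos_of_nonneg_of_nonpos hα.le (sub_nonpos.2 hgt.le))
      (ellNorm_le_lintegral_of_one_lt hgt hm (ellNorm_ne_top hgt.le hsum.le) hanti hmaj)

theorem condRenyi_le_renyi_fanoType1 (hL : 1 ≤ L) (hε : 0 ≤ ε)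
    (h : ∑ i ∈ Finset.range L, sortedMass Q i ≤ 1 - ε) (hX : Measurable X) (hY : Measurable Y)
    (herr : listError L μ X Y ≤ ε) (hQ : μ.map X = Q.toMeasure) (kind : Kind) {α : ℝ}
    (hα : 0 < α) : condRenyi kind α μ X Y ≤ renyi α (fanoType1 Q L ε) := by
  have harimoto := condRenyi_arimoto_le_renyi_fanoType1 μ hL hε h hX hY herr hQ hα
  cases kind with
  | arimoto => exact harimoto
  | hayashi => exact (condRenyi_hayashi_le_arimoto μ hY hα).trans harimoto

theorem listError_one_le (μ : Measure Ω) (X Y : Ω → ℕ+) :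
    listError 1 μ X Y ≤ μ.real {ω | X ω ≠ Y ω} := by
  have hbdd : BddBelow {p : ℝ | ∃ f : ℕ+ → Finset ℕ+,
      IsListDecoder 1 f ∧ p = μ.real {ω | X ω ∉ f (Y ω)}} := by
    refine ⟨0, ?_⟩
    rintro _ ⟨f, -, rfl⟩
    exact measureReal_nonneg
  have hsingleton : IsListDecoder 1 fun y : ℕ+ => {y} :=
    ⟨fun _ => ⟨le_rfl, le_rfl⟩, fun _ => .of_discrete⟩
  exact csInf_le hbdd ⟨_, hsingleton, by simp only [Finset.mem_singleton, ne_eq]⟩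

theorem fanoType1_nonneg (hL : 1 ≤ L) (h : ∑ i ∈ Finset.range L, sortedMass Q i ≤ 1 - ε)
    (x : ℕ+) : 0 ≤ fanoType1 Q L ε x := by
  simpa [fanoSeq] using fanoSeq_nonneg Q hL h x.natPred

theorem hasSum_fanoType1 (hL : 1 ≤ L) (hε : 0 ≤ ε)
    (h : ∑ i ∈ Finset.range L, sortedMass Q i ≤ 1 - ε) : HasSum (fanoType1 Q L ε) 1 :=
  (Equiv.pnatEquivNat.symm.hasSum_iff (f := fanoType1 Q L ε)).1 (hasSum_fanoSeq Q hL hε h)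

theorem tsum_decr_subtype_le_one (Q : PMF ℕ+) (p : ℕ+ → Prop) :
    ∑' x : {x : ℕ+ // p x}, decr Q (x : ℕ+) ≤ 1 := by
  have hsum : HasSum (fun x : ℕ+ => decr Q x) 1 :=
    (Equiv.pnatEquivNat.symm.hasSum_iff (f := fun x : ℕ+ => decr Q x)).1 (hasSum_sortedMass Q)
  have hnonneg (x : ℕ+) : 0 ≤ decr Q x := sortedMass_natPred Q x ▸ sortedMass_nonneg Q _
  exact (hsum.summable.tsum_subtype_le _ {x | p x} hnonneg).trans_eq hsum.tsum_eq

end FanoInequality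

end FanoRenyi

end

open FanoRenyi in
theorem corollary1_general {Ω 𝒴 : Type*} [MeasurableSpace Ω] [MeasurableSpace 𝒴]
    (μ : Measure Ω) [IsProbabilityMeasure μ]
    (Q : PMF ℕ+) (L : ℕ) (hL : 1 ≤ L) (ε : ℝ)
    (hε : 0 ≤ ε) (hε_upper : ε ≤ 1 - ∑ x ∈ Finset.Icc 1 L, decr Q x) :
    ((∀ x, 0 ≤ fanoType1 Q L ε x) ∧ HasSum (fanoType1 Q L ε) 1) ∧
    (∀ (kind : Kind) (α : ℝ), 0 < α →
      (⨆ (X : Ω → ℕ+) (Y : Ω → 𝒴) (_ : Measurable X) (_ : Measurable Y)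
        (_ : listError L μ X Y ≤ ε) (_ : μ.map X = Q.toMeasure), condRenyi kind α μ X Y)
        ≤ renyi α (fanoType1 Q L ε)) ∧
    (∀ α : ℝ, 0 < α → α ≠ 1 →
      renyi α (fanoType1 Q L ε) =
        ((1 / (1 - α) : ℝ) : EReal) * ENNReal.log
          (((L + 1 - indexJ Q L ε : ℕ) : ℝ≥0∞)
              * ENNReal.ofReal (weightV Q L ε (indexJ Q L ε)) ^ α
            + ((indexK Q L ε - (L : ℕ∞) : ℕ∞) : ℝ≥0∞)
              * ENNReal.ofReal (weightW Q L ε (indexK Q L ε)) ^ α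
            + ∑' x : {x : ℕ+ // (x : ℕ) < indexJ Q L ε ∨ indexK Q L ε < ((x : ℕ) : ℕ∞)},
                ENNReal.ofReal (decr Q (x : ℕ+)) ^ α)) ∧
    (renyi 1 (fanoType1 Q L ε) =
        ((((L + 1 - indexJ Q L ε : ℕ) : ℝ≥0∞)
              * ENNReal.ofReal (Real.negMulLog (weightV Q L ε (indexJ Q L ε)))
            + ((indexK Q L ε - (L : ℕ∞) : ℕ∞) : ℝ≥0∞)
              * ENNReal.ofReal (Real.negMulLog (weightW Q L ε (indexK Q L ε)))
            + ∑' x : {x : ℕ+ // (x : ℕ) < indexJ Q L ε ∨ indexK Q L ε < ((x : ℕ) : ℕ∞)},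
                ENNReal.ofReal (Real.negMulLog (decr Q (x : ℕ+))) : ℝ≥0∞) : EReal)) ∧
    (L = 1 →
      (⨆ (X : Ω → ℕ+) (Y : Ω → ℕ+) (_ : Measurable X) (_ : Measurable Y)
        (_ : μ.real {ω | X ω ≠ Y ω} ≤ ε) (_ : μ.map X = Q.toMeasure), condShannon μ X Y)
        ≤ ENNReal.ofReal (Real.negMulLog (1 - ε))
          + ((indexK Q 1 ε - 1 : ℕ∞) : ℝ≥0∞)
            * ENNReal.ofReal (Real.negMulLog (weightW Q 1 ε (indexK Q 1 ε)))
          + ∑' x : {x : ℕ+ // indexK Q 1 ε < ((x : ℕ) : ℕ∞)},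
              ENNReal.ofReal (Real.negMulLog (decr Q (x : ℕ+)))) := by
  have h : ∑ i ∈ Finset.range L, sortedMass Q i ≤ 1 - ε := by
    rw [← sum_Icc_decr]
    linarith
  refine ⟨⟨fanoType1_nonneg hL h, hasSum_fanoType1 hL hε h⟩, fun kind α hα => ?_,
    fun α _ hα1 => ?_, ?_, ?_⟩
  · simp only [iSup_le_iff]
    exact fun X Y hX hY herr hQ => condRenyi_le_renyi_fanoType1 μ hL hε h hX hY herr hQ kind hα
  · rw [renyi, if_neg hα1, powerSum, tsum_fanoType1 Q hL fun u => ENNReal.ofReal u ^ α]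
  · rw [renyi, if_pos rfl, shannon,
      tsum_fanoType1 Q hL fun u => ENNReal.ofReal (Real.negMulLog u)]
  · rintro rfl
    rw [← shannon_fanoType1_one Q h]
    simp only [iSup_le_iff]
    exact fun X Y hX hY herr hQ => condShannon_le_shannon_fanoType1 μ le_rfl hε h hX hY
      ((listError_one_le μ X Y).trans herr) hQ

open FanoRenyi in
theorem corollary1 {Ω 𝒴 : Type*} [MeasurableSpace Ω] [MeasurableSpace 𝒴]
    (μ : Measure Ω) [IsProbabilityMeasure μ]
    (Q : PMF ℕ+) (L : ℕ) (hL : 1 ≤ L) (ε : ℝ)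
    (hε_lower :
      1 - ∑' x : {x : ℕ+ // ((x : ℕ) : ℕ∞) ≤ ENat.card 𝒴 * (L : ℕ∞)}, decr Q (x : ℕ+) ≤ ε)
    (hε_upper : ε ≤ 1 - ∑ x ∈ Finset.Icc 1 L, decr Q x) :
    -- the Fano-distribution of type 1 is a probability distribution
    ((∀ x, 0 ≤ fanoType1 Q L ε x) ∧ HasSum (fanoType1 Q L ε) 1) ∧
    -- the Fano-type inequality, for Arimoto's and for Hayashi's entropy
    (∀ (kind : Kind) (α : ℝ), 0 < α →
      (⨆ (X : Ω → ℕ+) (Y : Ω → 𝒴) (_ : Measurable X) (_ : Measurable Y)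
        (_ : listError L μ X Y ≤ ε) (_ : μ.map X = Q.toMeasure), condRenyi kind α μ X Y)
        ≤ renyi α (fanoType1 Q L ε)) ∧
    -- the explicit value of the bound
    (∀ α : ℝ, 0 < α → α ≠ 1 →
      renyi α (fanoType1 Q L ε) =
        ((1 / (1 - α) : ℝ) : EReal) * ENNReal.log
          (((L + 1 - indexJ Q L ε : ℕ) : ℝ≥0∞)
              * ENNReal.ofReal (weightV Q L ε (indexJ Q L ε)) ^ α
            + ((indexK Q L ε - (L : ℕ∞) : ℕ∞) : ℝ≥0∞)
              * ENNReal.ofReal (weightW Q L ε (indexK Q L ε)) ^ α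
            + ∑' x : {x : ℕ+ // (x : ℕ) < indexJ Q L ε ∨ indexK Q L ε < ((x : ℕ) : ℕ∞)},
                ENNReal.ofReal (decr Q (x : ℕ+)) ^ α)) ∧
    (renyi 1 (fanoType1 Q L ε) =
        ((((L + 1 - indexJ Q L ε : ℕ) : ℝ≥0∞)
              * ENNReal.ofReal (Real.negMulLog (weightV Q L ε (indexJ Q L ε)))
            + ((indexK Q L ε - (L : ℕ∞) : ℕ∞) : ℝ≥0∞)
              * ENNReal.ofReal (Real.negMulLog (weightW Q L ε (indexK Q L ε)))
            + ∑' x : {x : ℕ+ // (x : ℕ) < indexJ Q L ε ∨ indexK Q L ε < ((x : ℕ) : ℕ∞)},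
                ENNReal.ofReal (Real.negMulLog (decr Q (x : ℕ+))) : ℝ≥0∞) : EReal)) ∧
    -- the case `α = 1`, `L = 1`: the Ho–Verdú–Fano inequality
    (L = 1 →
      (⨆ (X : Ω → ℕ+) (Y : Ω → ℕ+) (_ : Measurable X) (_ : Measurable Y)
        (_ : μ.real {ω | X ω ≠ Y ω} ≤ ε) (_ : μ.map X = Q.toMeasure), condShannon μ X Y)
        ≤ ENNReal.ofReal (Real.negMulLog (1 - ε))
          + ((indexK Q 1 ε - 1 : ℕ∞) : ℝ≥0∞)
            * ENNReal.ofReal (Real.negMulLog (weightW Q 1 ε (indexK Q 1 ε)))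
          + ∑' x : {x : ℕ+ // indexK Q 1 ε < ((x : ℕ) : ℕ∞)},
              ENNReal.ofReal (Real.negMulLog (decr Q (x : ℕ+)))) :=
  corollary1_general μ Q L hL ε
    (hε_lower.trans' (sub_nonneg.2 (tsum_decr_subtype_le_one Q _))) hε_upper
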